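/- Let $\omega_1,\omega_2,\gamma,\varepsilon\in\mathbb C$, put $\delta=\omega_2/\omega_1$, and assume $\operatorname{Im}\delta>0$ and $0<\operatorname{Im}\gamma<\operatorname{Im}\delta$. Write $p=e^{2\pi i\delta}$, $q=e^{2\pi i\gamma}$. **Integral operator.** Let $\zeta(z)=\zeta(z;2\omega_1,2\omega_2)$ be the Weierstrass zeta function. For a function $f$ of period $1$ on $\mathbb R$ put $$(\mathsf Tf)(x)=\frac{i\omega_1}{\pi}\,\mathrm{PV}\!\!\int_{-1/2}^{1/2}\Big[\zeta(2\omega_1(y-x-\gamma))-2\zeta(2\omega_1(y-x))+\zeta(2\omega_1(y-x+\gamma))\Big]f(y)\,dy ,$$ where the principal value is the limit, as $r\to0^+$, of the integral over those $y\in[-1/2,1/2]$ whose distance to $x+\mathbb Z$ exceeds $r$. **Poisson structure.** The generators $\lambda_n$ ($n\in\mathbb Z\setminus\{0\}$) are the coordinate functions on the phase space $\ell^1(\mathbb Z\setminus\{0\})$ of complex sequences, with $$\{\lambda_n,\lambda_m\}=c_n\,\delta_{n+m,0},\qquad c_n=\frac{(1-q^n)(1-p^nq^{-n})}{1-p^n},$$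 and, for functions $F,G$ on the phase space, $\{F,G\}=\sum_{n\ne0}c_n\,\frac{\partial F}{\partial\lambda_n}\frac{\partial G}{\partial\lambda_{-n}}$ whenever this series converges. For real $x$ put $$\eta(x)=\varepsilon\exp\Big(\sum_{n\neq0}\lambda_ne^{-2\pi inx}\Big).$$ **Hamiltonians and densities.** Let $\vartheta_1(x)=-ip^{1/8}e^{\pi ix}\sum_{m\in\mathbb Z}(-1)^mp^{m(m+1)/2}e^{2\pi imx}$ with $p^{1/8}=e^{\pi i\delta/4}$, and $\vartheta_1'=\vartheta_1'(0)$. For $n\ge1$ put $$C_n=(-1)^{n-1}\frac{(\vartheta_1')^{n-1}\,\vartheta_1(n\gamma)}{(2\pi i)^{n-1}\,\vartheta_1(\gamma)^n},\qquad K_n(x_1,\dots,x_n)=\prod_{1\le i<j\le n}\frac{\vartheta_1(x_i-x_j)^2}{\vartheta_1(x_i-x_j+\gamma)\,\vartheta_1(x_i-x_j-\gamma)},$$ $$I_n=\frac{C_n}{n!}\int_{[-1/2,1/2]^n}K_n(x_1,\dots,x_n)\,\eta(x_1)\cdots\eta(x_n)\,dx_1\cdots dx_n,$$ $$H_n(x_1)=\frac{C_n}{(n-1)!}\int_{[-1/2,1/2]^{n-1}}K_n(x_1,\dots,x_n)\,\eta(x_1)\cdots\eta(x_n)\,dx_2\cdots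 dx_n .$$ **Proposition.** Let $n\ge1$. Then $n\,I_n=\int_{-1/2}^{1/2}H_n(x)\,dx$. The functions $I_n$ and $\eta(x)$ ($x\in\mathbb R$) are complex differentiable on the phase space. For every $x\in\mathbb R$ and at every point of the phase space the series for $\{I_n,\eta(x)\}$ and the principal value $(\mathsf TH_n)(x)$ converge, and $$\{I_n,\eta(x)\}=\eta(x)\,(\mathsf TH_n)(x).$$ Consequently, whenever a curve $t_n\mapsto\lambda(t_n)$ in the phase space is differentiable in the $\ell^1$ norm and moves along the Hamiltonian flow of $I_n$, that is, $d\lambda_k/dt_n=\{I_n,\lambda_k\}$ for all $k$, one has along it, for every real $x$, $$\frac{\partial\eta(x)}{\partial t_n}=\{I_n,\eta(x)\}=\eta(x)\,(\mathsf TH_n)(x).$$ For $n=1$ one has $H_1=\eta$, and $\eta(x,t_1)$ satisfies the integro-differential equation $\partial\eta/\partial t_1=\eta\cdot\mathsf T\eta$. -/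

import Mathlib

open scoped Topology

noncomputable section

namespace EllipticILW

/-! ### The singular integral operator -/

/-- The lattice point `2 m ω₁ + 2 n ω₂`. -/
def latticePoint (ω₁ ω₂ : ℂ) (mn : ℤ × ℤ) : ℂ := 2 * mn.1 * ω₁ + 2 * mn.2 * ω₂

/-- The Weierstrass zeta function `ζ(z; 2ω₁, 2ω₂)`. -/
def weierstrassZeta (ω₁ ω₂ z : ℂ) : ℂ :=
  1 / z + ∑' mn : {mn : ℤ × ℤ // mn ≠ 0},
    (1 / (z - latticePoint ω₁ ω₂ mn) + 1 / latticePoint ω₁ ω₂ mn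
      + z / latticePoint ω₁ ω₂ mn ^ 2)

/-- The discrete Laplacian `(Δ_γ f)(z) = f(z - γ) - 2 f(z) + f(z + γ)`. -/
def discreteLaplacian (γ : ℂ) (f : ℂ → ℂ) (z : ℂ) : ℂ := f (z - γ) - 2 * f z + f (z + γ)

/-- The kernel of the operator, as a function of `z = y - x`.  The discrete Laplacian acts in the
variable `z`, in which the periods are `1` and `δ = ω₂ / ω₁`. -/
def kernelT (ω₁ ω₂ γ z : ℂ) : ℂ :=
  discreteLaplacian γ (fun w => weierstrassZeta ω₁ ω₂ (2 * ω₁ * w)) z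

/-- The integral over the period `[-1/2, 1/2]` with the `r`-neighbourhood of the singular point
`y ≡ x mod 1` removed.  (`|s - round s|` is the distance from `s` to the nearest integer.) -/
def truncatedT (ω₁ ω₂ γ : ℂ) (f : ℝ → ℂ) (x r : ℝ) : ℂ :=
  Complex.I * ω₁ / Real.pi *
    ∫ y in {y : ℝ | y ∈ Set.Icc (-1 / 2) (1 / 2) ∧ r < |(y - x) - round (y - x)|},
      kernelT ω₁ ω₂ γ ((y - x : ℝ) : ℂ) * f y

/-- The principal value defining `(𝖳 f)(x)` exists. -/
def ConvergesT (ω₁ ω₂ γ : ℂ) (f : ℝ → ℂ) (x : ℝ) : Prop :=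
  ∃ v : ℂ, Filter.Tendsto (fun r => truncatedT ω₁ ω₂ γ f x r) (𝓝[>] 0) (𝓝 v)

/-- `(𝖳 f)(x) = (i ω₁ / π) PV ∫_{-1/2}^{1/2} (Δ_γ ζ)(2 ω₁ (y - x)) f(y) dy`. -/
def operatorT (ω₁ ω₂ γ : ℂ) (f : ℝ → ℂ) (x : ℝ) : ℂ :=
  Filter.limUnder (𝓝[>] 0) (fun r => truncatedT ω₁ ω₂ γ f x r)

/-- The integro-differential equation `∂u/∂t = u · 𝖳 u` holds for `u = u(x, t)` at `(x, t)`
(the principal value being convergent). -/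
def SatisfiesILWAt (ω₁ ω₂ γ : ℂ) (u : ℝ → ℝ → ℂ) (x t : ℝ) : Prop :=
  ConvergesT ω₁ ω₂ γ (fun y => u y t) x ∧
    HasDerivAt (fun s => u x s) (u x t * operatorT ω₁ ω₂ γ (fun y => u y t) x) t

/-! ### The Poisson structure -/

/-- The index set `ℤ \ {0}` of the generators. -/
abbrev Mode : Type := {n : ℤ // n ≠ 0}

/-- The involution `n ↦ -n`. -/
def Mode.opp (n : Mode) : Mode := ⟨-n.1, neg_ne_zero.mpr n.2⟩

/-- Phase space `ℓ¹(ℤ \ {0})`; the generators `λ_n` are its coordinate functions. -/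
abbrev Phase : Type := lp (fun _ : Mode => ℂ) 1

/-- The generator `λ_n`. -/
def coord (n : Mode) : Phase → ℂ := fun lam => lam n

/-- The partial derivative `∂F / ∂λ_n`. -/
def partialD (n : Mode) (F : Phase → ℂ) (lam : Phase) : ℂ :=
  fderiv ℂ F lam (lp.single 1 n (1 : ℂ))

/-- `c_n = (1 - q^n) (1 - p^n q^{-n}) / (1 - p^n)` with `q = e^{2πiγ}` and `p = e^{2πiδ}`. -/
def structureConst (δ γ : ℂ) (n : ℤ) : ℂ :=
  (1 - Complex.exp (2 * Real.pi * Complex.I * γ) ^ n) *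
      (1 - Complex.exp (2 * Real.pi * Complex.I * δ) ^ n *
        Complex.exp (2 * Real.pi * Complex.I * γ) ^ (-n)) /
    (1 - Complex.exp (2 * Real.pi * Complex.I * δ) ^ n)

/-- The general term of `{F, G} = ∑_n c_n (∂F/∂λ_n) (∂G/∂λ_{-n})`. -/
def bracketTerm (δ γ : ℂ) (F G : Phase → ℂ) (lam : Phase) (n : Mode) : ℂ :=
  structureConst δ γ n * partialD n F lam * partialD n.opp G lam

/-- The series for the bracket `{F, G}` converges (absolutely) at `lam`. -/
def BracketConverges (δ γ : ℂ) (F G : Phase → ℂ) (lam : Phase) : Prop :=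
  Summable (bracketTerm δ γ F G lam)

/-- The Poisson bracket, that is, the derivation in each argument with
`{λ_n, λ_m} = c_n δ_{n+m,0}` (see `bracket_coord`, `bracket_mul`, `bracket_antisymm`). -/
def bracket (δ γ : ℂ) (F G : Phase → ℂ) (lam : Phase) : ℂ :=
  ∑' n : Mode, bracketTerm δ γ F G lam n

theorem partialD_coord (n m : Mode) (lam : Phase) :
    partialD n (coord m) lam = if n = m then 1 else 0 := by
  have h : HasFDerivAt (coord m) (lp.evalCLM (p := 1) ℂ (fun _ : Mode => ℂ) m) lam :=
    (lp.evalCLM (p := 1) ℂ (fun _ : Mode => ℂ) m).hasFDerivAt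
  unfold partialD
  rw [h.fderiv]
  change (lp.single 1 n (1 : ℂ) : Phase) m = _
  by_cases hnm : n = m
  · subst hnm
    simp
  · rw [lp.single_apply_ne _ _ _ (Ne.symm hnm), if_neg hnm]

/-- The defining relation of the Poisson algebra. -/
theorem bracket_coord (δ γ : ℂ) (n m : Mode) (lam : Phase) :
    bracket δ γ (coord n) (coord m) lam =
      if (n : ℤ) + (m : ℤ) = 0 then structureConst δ γ n else 0 := by
  have hiff : n.opp = m ↔ (n : ℤ) + (m : ℤ) = 0 := by
    rw [Subtype.ext_iff]
    change -(n : ℤ) = m ↔ _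
    omega
  unfold bracket
  rw [tsum_eq_single n]
  · by_cases h : (n : ℤ) + (m : ℤ) = 0
    · simp [bracketTerm, partialD_coord, h, hiff.mpr h]
    · simp [bracketTerm, partialD_coord, h, mt hiff.mp h]
  · intro k hk
    simp [bracketTerm, partialD_coord, hk]

/-- The Leibniz rule. -/
theorem bracket_mul (δ γ : ℂ) (F G K : Phase → ℂ) (lam : Phase)
    (hG : DifferentiableAt ℂ G lam) (hK : DifferentiableAt ℂ K lam)
    (hFG : BracketConverges δ γ F G lam) (hFK : BracketConverges δ γ F K lam) :
    bracket δ γ F (fun l => G l * K l) lam =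
      G lam * bracket δ γ F K lam + K lam * bracket δ γ F G lam := by
  unfold bracket
  rw [← tsum_mul_left, ← tsum_mul_left, ← (hFK.mul_left _).tsum_add (hFG.mul_left _)]
  refine tsum_congr fun n => ?_
  have h : partialD n.opp (fun l => G l * K l) lam =
      G lam * partialD n.opp K lam + K lam * partialD n.opp G lam := by
    unfold partialD
    have := (hG.hasFDerivAt.mul hK.hasFDerivAt).fderiv
    change fderiv ℂ (fun l => G l * K l) lam = _ at this
    rw [this]
    simp
  simp only [bracketTerm, h]
  ring

/-- Antisymmetry. -/
theorem bracket_antisymm (δ γ : ℂ) (F G : Phase → ℂ) (lam : Phase) (hδ : 0 < δ.im) :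
    bracket δ γ F G lam = -bracket δ γ G F lam := by
  have hopp : Function.Involutive Mode.opp := fun n => by
    apply Subtype.ext
    change -(-(n : ℤ)) = n
    ring
  have hp1 : ∀ n : ℤ, n ≠ 0 → (1 - Complex.exp (2 * Real.pi * Complex.I * δ) ^ n) ≠ 0 := by
    intro n hn h0
    have h1 : ‖Complex.exp (2 * Real.pi * Complex.I * δ) ^ n‖ = 1 := by
      rw [← sub_eq_zero.mp h0]
      simp
    rw [← Complex.exp_int_mul, Complex.norm_exp, Real.exp_eq_one_iff] at h1
    simp [hn, Real.pi_ne_zero, hδ.ne'] at h1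
  have hc : ∀ n : Mode, structureConst δ γ n.opp = -structureConst δ γ n := by
    intro n
    have hp := hp1 n n.2
    have hp' := hp1 (-n) (neg_ne_zero.mpr n.2)
    unfold structureConst
    change (1 - Complex.exp (2 * Real.pi * Complex.I * γ) ^ (-(n : ℤ))) *
      (1 - Complex.exp (2 * Real.pi * Complex.I * δ) ^ (-(n : ℤ)) *
        Complex.exp (2 * Real.pi * Complex.I * γ) ^ (-(-(n : ℤ)))) /
      (1 - Complex.exp (2 * Real.pi * Complex.I * δ) ^ (-(n : ℤ))) = _
    rw [← neg_div, div_eq_div_iff hp' hp]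
    have hP := zpow_ne_zero (n : ℤ) (Complex.exp_ne_zero (2 * Real.pi * Complex.I * δ))
    have hQ := zpow_ne_zero (n : ℤ) (Complex.exp_ne_zero (2 * Real.pi * Complex.I * γ))
    simp only [neg_neg, zpow_neg]
    field_simp
    ring
  unfold bracket
  rw [← tsum_neg, ← (Equiv.tsum_eq hopp.toPerm)]
  refine tsum_congr fun n => ?_
  change bracketTerm δ γ F G lam n.opp = _
  simp only [bracketTerm, hc, hopp n]
  ring

/-- The curve `Λ` in phase space moves, at time `t`, along the Hamiltonian vector field of `F`:
`d λ_k / dt = {F, λ_k}` for all `k`. -/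
def IsHamiltonianFlowAt (δ γ : ℂ) (F : Phase → ℂ) (Λ : ℝ → Phase) (t : ℝ) : Prop :=
  ∃ v : Phase, HasDerivAt Λ v t ∧ ∀ k : Mode, v k = bracket δ γ F (coord k) (Λ t)

/-- `η(x) = ε exp (∑_{n ≠ 0} λ_n e^{-2πinx})`. -/
def eta (ε : ℂ) (lam : Phase) (x : ℝ) : ℂ :=
  ε * Complex.exp (∑' n : Mode, lam n * Complex.exp (-(2 * Real.pi * Complex.I * (n : ℤ) * x)))

/-! ### The Hamiltonians and their densities -/

/-- `ϑ₁(x; δ) = -i p^{1/8} e^{πix} ∑_m (-1)^m p^{m(m+1)/2} e^{2πimx}`, with `p = e^{2πiδ}` and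
`p^{1/8} = e^{πiδ/4}`. -/
def theta1 (δ x : ℂ) : ℂ :=
  -Complex.I * Complex.exp (Real.pi * Complex.I * δ / 4) * Complex.exp (Real.pi * Complex.I * x) *
    ∑' m : ℤ, (-1 : ℂ) ^ m *
      Complex.exp (Real.pi * Complex.I * δ * (m * (m + 1)) + 2 * Real.pi * Complex.I * m * x)

/-- The kernel `∏_{i<j} ϑ₁(x_i-x_j)² / (ϑ₁(x_i-x_j+γ) ϑ₁(x_i-x_j-γ))`. -/
def pairKernel (δ γ : ℂ) {n : ℕ} (x : Fin n → ℝ) : ℂ :=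
  ∏ i : Fin n, ∏ j ∈ Finset.Ioi i,
    theta1 δ (x i - x j) ^ 2 / (theta1 δ (x i - x j + γ) * theta1 δ (x i - x j - γ))

/-- The constant `(-1)^{n-1} (ϑ₁')^{n-1} ϑ₁(nγ) / ((2πi)^{n-1} ϑ₁(γ)^n)`, with `ϑ₁' = ϑ₁'(0)`;
only used for `n ≥ 1`. -/
def prefactor (δ γ : ℂ) (n : ℕ) : ℂ :=
  (-1) ^ (n - 1) * (deriv (theta1 δ) 0 ^ (n - 1) * theta1 δ (n * γ) /
    ((2 * Real.pi * Complex.I) ^ (n - 1) * theta1 δ γ ^ n))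

/-- The cube `[-1/2, 1/2]^n`. -/
def cube (n : ℕ) : Set (Fin n → ℝ) := Set.Icc (fun _ => -1 / 2) (fun _ => 1 / 2)

/-- The Hamiltonian `I_n` (for `n ≥ 1`), as a function on phase space. -/
def hamiltonian (δ γ ε : ℂ) (n : ℕ) (lam : Phase) : ℂ :=
  prefactor δ γ n / (n.factorial : ℂ) *
    ∫ x in cube n, pairKernel δ γ x * ∏ i : Fin n, eta ε lam (x i)

/-- The density `H_n(x₁)` (for `n ≥ 1`): an integral over the `n - 1` variables `x₂, …, x_n`. -/
def density (δ γ ε : ℂ) (n : ℕ) (lam : Phase) (x₁ : ℝ) : ℂ :=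
  match n with
  | 0 => 0
  | m + 1 =>
    prefactor δ γ (m + 1) / (m.factorial : ℂ) *
      ∫ y in cube m, pairKernel δ γ (Fin.cons x₁ y : Fin (m + 1) → ℝ) *
        ∏ i : Fin (m + 1), eta ε lam ((Fin.cons x₁ y : Fin (m + 1) → ℝ) i)

end EllipticILW

end

open EllipticILW

open scoped BoundedContinuousFunction

noncomputable section

namespace EllipticILW

/-! ### Absolutely convergent Fourier series -/

/-! Everything is diagonal in Fourier space: on absolutely convergent Fourier series, `𝖳` is the
multiplier with symbol `c_k`, the structure constants of the bracket. Since `∂η(x)/∂λ_{-k} = η(x)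
e^{2πikx}`, and `∂I_n/∂λ_k` is the `k`-th Fourier coefficient `h_k` of `H_n`, the bracket series is
`η(x) ∑ c_k h_k e^{2πikx}`, which is `η(x) (𝖳 H_n)(x)`.

The multiplier (`tendsto_truncatedT`). The second difference in `γ` annihilates the affine
correction terms of `ζ`, so the kernel is an absolutely convergent lattice sum of second differences
of `1/z`. Summing along rows gives `π cot`, and expanding the rows off the real axis in powers of
`e^{2πiz}` gives `exists_kernelT_eq`: on the real line the normalised kernel is `-i cot(πs)` plus a
Fourier series with coefficients `sign k - c_k`. The principal value of the cotangent part against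
`e^{2πiks}` is `sign k`, and as `c` is odd the total is `c_k`. A bound on the truncated multipliers,
uniform in `k` and `r`, permits `r → 0` under the sum.

Regularity of `H_n` (`exists_hasFourier_density`). Absolutely convergent Fourier series are closed
under products, exponentials and integrating out variables. The exponent of `η` is one because `λ`
is in `ℓ¹`; each factor of the pair kernel is one because it is smooth and periodic, which rests on
`theta1_ne_zero`: `ϑ₁` has no zeros in the open strip `0 < Im x < Im δ`.

The derivative of `I_n` (`partialD_hamiltonian`). The product of the `η(x_i)` is `ε^n` times an
exponential in the Banach algebra of bounded continuous functions, so `I_n` is a scalar times a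
composite of continuous linear maps with `exp`. Symmetry of `K_n` turns the derivative into an
integral of `H_n`. Along the flow, the chain rule in `ℓ¹` reproduces the bracket series with `k`
replaced by `-k`. -/

/-- The character `x ↦ e^{2πikx}` of `ℝ`. -/
def mode (k : ℤ) (x : ℝ) : ℂ := Complex.exp (2 * Real.pi * Complex.I * k * x)

theorem mode_add_index (k l : ℤ) (x : ℝ) : mode (k + l) x = mode k x * mode l x := by
  simp only [mode, ← Complex.exp_add]
  congr 1
  push_cast
  ring

theorem mode_add (k : ℤ) (x y : ℝ) : mode k (x + y) = mode k x * mode k y := by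
  simp only [mode, ← Complex.exp_add]
  congr 1
  push_cast
  ring

@[simp] theorem mode_zero (x : ℝ) : mode 0 x = 1 := by simp [mode]

@[simp] theorem mode_at_zero (k : ℤ) : mode k 0 = 1 := by simp [mode]

@[simp] theorem norm_mode (k : ℤ) (x : ℝ) : ‖mode k x‖ = 1 := by
  simp [mode, Complex.norm_exp]

theorem mode_one (k : ℤ) : mode k 1 = 1 := by
  rw [mode, Complex.exp_eq_one_iff]
  exact ⟨k, by push_cast; ring⟩

theorem mode_periodic (k : ℤ) : Function.Periodic (mode k) 1 := fun x => by
  rw [mode_add, mode_one, mul_one]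

theorem mode_neg (k : ℤ) (x : ℝ) : mode k (-x) = mode (-k) x := by
  simp [mode]

@[fun_prop] theorem continuous_mode (k : ℤ) : Continuous (mode k) := by
  unfold mode
  fun_prop

/-- The character `x ↦ e^{2πik·x}` of `ℝⁿ`. -/
def character {n : ℕ} (k : Fin n → ℤ) (x : Fin n → ℝ) : ℂ := ∏ j, mode (k j) (x j)

@[simp] theorem norm_character {n : ℕ} (k : Fin n → ℤ) (x : Fin n → ℝ) :
    ‖character k x‖ = 1 := by
  simp [character, norm_prod]

theorem character_add_index {n : ℕ} (k l : Fin n → ℤ) (x : Fin n → ℝ) :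
    character (k + l) x = character k x * character l x := by
  simp [character, mode_add_index, Finset.prod_mul_distrib]

@[fun_prop] theorem continuous_character {n : ℕ} (k : Fin n → ℤ) : Continuous (character k) := by
  unfold character
  fun_prop

/-- `f` is the sum of a Fourier series whose coefficients have absolute values of sum `≤ M`. -/
def AbsFourierLE {n : ℕ} (M : ℝ) (f : (Fin n → ℝ) → ℂ) : Prop :=
  ∃ (ι : Type) (_ : Countable ι) (k : ι → Fin n → ℤ) (a : ι → ℂ), Summable (fun i => ‖a i‖) ∧ ∑' i, ‖a i‖ ≤ M ∧
    ∀ x, HasSum (fun i => a i * character (k i) x) (f x)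

/-- `f` is the sum of an absolutely convergent Fourier series. -/
def AbsFourier {n : ℕ} (f : (Fin n → ℝ) → ℂ) : Prop := ∃ M, AbsFourierLE M f

theorem AbsFourierLE.const {n : ℕ} (c : ℂ) : AbsFourierLE ‖c‖ (fun _ : Fin n → ℝ => c) :=
  ⟨Unit, inferInstance, fun _ => 0, fun _ => c, (hasSum_unique _).summable, by simp, fun x => by
    simp [character]⟩

theorem AbsFourierLE.mul {n : ℕ} {M N : ℝ} {f g : (Fin n → ℝ) → ℂ} (hf : AbsFourierLE M f)
    (hg : AbsFourierLE N g) : AbsFourierLE (M * N) (fun x => f x * g x) := by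
  obtain ⟨ι, hι, k, a, ha, haM, hfa⟩ := hf
  obtain ⟨κ, hκ, l, b, hb, hbN, hgb⟩ := hg
  have hs : Summable fun p : ι × κ => ‖a p.1 * b p.2‖ := Summable.mul_norm ha hb
  refine ⟨ι × κ, inferInstance, fun p => k p.1 + l p.2, fun p => a p.1 * b p.2, hs, ?_, fun x => ?_⟩
  · have : ∑' p : ι × κ, ‖a p.1 * b p.2‖ = (∑' i, ‖a i‖) * ∑' j, ‖b j‖ := by
      simp only [norm_mul]
      rw [Summable.tsum_mul_tsum ha hb]
      simpa using hs
    rw [this]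
    exact mul_le_mul haM hbN (tsum_nonneg fun _ => norm_nonneg _)
      ((tsum_nonneg fun _ => norm_nonneg _).trans haM)
  · have := (hfa x).mul (hgb x) (by
      refine Summable.of_norm (hs.congr fun p => ?_)
      simp)
    refine this.congr_fun ?_ |> id
    intro p
    simp [character_add_index]
    ring

theorem AbsFourierLE.pow {n : ℕ} {M : ℝ} {f : (Fin n → ℝ) → ℂ} (hf : AbsFourierLE M f) (N : ℕ) :
    AbsFourierLE (M ^ N) (fun x => f x ^ N) := by
  induction N with
  | zero => simpa using AbsFourierLE.const (n := n) 1
  | succ N ih => simpa [pow_succ] using ih.mul hf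

/-- A summable family of absolutely convergent series is one double series over a sigma type. This
is why the bound `M` is carried explicitly and why the index type is arbitrary: no convolution of
coefficients has to be formed. -/
theorem AbsFourierLE.hasSum {n : ℕ} {M : ℕ → ℝ} {f : ℕ → (Fin n → ℝ) → ℂ}
    {g : (Fin n → ℝ) → ℂ} (hf : ∀ N, AbsFourierLE (M N) (f N)) (hM : Summable M)
    (hg : ∀ x, HasSum (fun N => f N x) (g x)) : AbsFourier g := by
  choose ι hι k a ha haM hfa using hf
  have hs : Summable fun p : Σ N, ι N => ‖a p.1 p.2‖ := by
    rw [summable_sigma_of_nonneg fun _ => norm_nonneg _]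
    exact ⟨ha, Summable.of_nonneg_of_le (fun N => tsum_nonneg fun _ => norm_nonneg _) haM hM⟩
  refine ⟨_, (Σ N, ι N), inferInstance, fun p => k p.1 p.2, fun p => a p.1 p.2, hs, le_rfl, fun x => ?_⟩
  have hs' : Summable fun p : Σ N, ι N => a p.1 p.2 * character (k p.1 p.2) x :=
    Summable.of_norm (hs.congr fun p => by simp)
  have := hs'.hasSum.sigma (fun N => hfa N x)
  rw [(hg x).unique this]
  exact hs'.hasSum

/-- Coefficient norms are submultiplicative, so the power series of `exp` is dominated by `∑ M ^ N /
N!`. -/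
theorem AbsFourier.exp {n : ℕ} {f : (Fin n → ℝ) → ℂ} (hf : AbsFourier f) :
    AbsFourier (fun x => Complex.exp (f x)) := by
  obtain ⟨M, hf⟩ := hf
  refine AbsFourierLE.hasSum (M := fun N => ‖((N.factorial : ℂ))⁻¹‖ * M ^ N)
    (fun N => (AbsFourierLE.const ((N.factorial : ℂ))⁻¹).mul (hf.pow N)) ?_ fun x => ?_
  · refine (Real.summable_pow_div_factorial M).congr fun N => ?_
    simp [div_eq_inv_mul]
  · rw [Complex.exp_eq_exp_ℂ]
    exact (NormedSpace.exp_series_hasSum_exp' (𝕂 := ℂ) (f x)).congr_fun fun N => by simp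

theorem AbsFourier.const {n : ℕ} (c : ℂ) : AbsFourier (fun _ : Fin n → ℝ => c) :=
  ⟨_, AbsFourierLE.const c⟩

theorem AbsFourier.mul {n : ℕ} {f g : (Fin n → ℝ) → ℂ} (hf : AbsFourier f)
    (hg : AbsFourier g) : AbsFourier (fun x => f x * g x) := by
  obtain ⟨M, hf⟩ := hf
  obtain ⟨N, hg⟩ := hg
  exact ⟨_, hf.mul hg⟩

theorem AbsFourier.prod {n : ℕ} {ι : Type*} (s : Finset ι) {f : ι → (Fin n → ℝ) → ℂ}
    (hf : ∀ i ∈ s, AbsFourier (f i)) : AbsFourier (fun x => ∏ i ∈ s, f i x) := by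
  classical
  induction s using Finset.induction_on with
  | empty => simpa using AbsFourier.const 1
  | insert i s hi ih =>
    simp only [Finset.prod_insert hi]
    exact (hf i (by simp)).mul (ih fun j hj => hf j (by simp [hj]))

theorem AbsFourier.continuous {n : ℕ} {f : (Fin n → ℝ) → ℂ} (hf : AbsFourier f) :
    Continuous f := by
  obtain ⟨_, ι, hι, k, a, ha, -, h⟩ := hf
  rw [funext fun x => (h x).tsum_eq.symm]
  exact continuous_tsum (fun i => by fun_prop) ha fun i x => by simp

/-- `f` is the sum of the absolutely convergent Fourier series with coefficients `a`. -/
structure HasFourier (f : ℝ → ℂ) (a : ℤ → ℂ) : Prop where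
  summable : Summable a
  hasSum : ∀ x, HasSum (fun k => a k * mode k x) (f x)

theorem HasFourier.continuous {f : ℝ → ℂ} {a : ℤ → ℂ} (h : HasFourier f a) : Continuous f := by
  rw [funext fun x => (h.hasSum x).tsum_eq.symm]
  exact continuous_tsum (fun i => by fun_prop) h.summable.norm fun i x => by simp

theorem HasFourier.periodic {f : ℝ → ℂ} {a : ℤ → ℂ} (h : HasFourier f a) :
    Function.Periodic f 1 := fun x => by
  refine (h.hasSum (x + 1)).unique ?_
  simpa only [mode_periodic _ x] using h.hasSum x

theorem HasFourier.const_mul {f : ℝ → ℂ} {a : ℤ → ℂ} (h : HasFourier f a) (c : ℂ) :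
    HasFourier (fun x => c * f x) (fun k => c * a k) :=
  ⟨h.summable.mul_left c, fun x => by
    simpa only [mul_assoc] using (h.hasSum x).mul_left c⟩

theorem HasFourier.comp_coord {n : ℕ} {f : ℝ → ℂ} {a : ℤ → ℂ} (h : HasFourier f a) (i : Fin n) :
    AbsFourier (fun x : Fin n → ℝ => f (x i)) := by
  refine ⟨_, ℤ, inferInstance, fun k => Pi.single i k, a, h.summable.norm, le_rfl, fun x => ?_⟩
  refine (h.hasSum (x i)).congr_fun fun k => ?_
  rw [character, Finset.prod_eq_single i (fun j _ hj => by simp [hj]) (by simp)]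
  simp

theorem HasFourier.comp_sub {n : ℕ} {f : ℝ → ℂ} {a : ℤ → ℂ} (h : HasFourier f a) (i j : Fin n) :
    AbsFourier (fun x : Fin n → ℝ => f (x i - x j)) := by
  refine ⟨_, ℤ, inferInstance, fun k => Pi.single i k + Pi.single j (-k), a, h.summable.norm, le_rfl,
    fun x => ?_⟩
  refine (h.hasSum (x i - x j)).congr_fun fun k => ?_
  have hs : ∀ (m : Fin n) (l : ℤ), character (Pi.single m l) x = mode l (x m) := fun m l => by
    rw [character, Finset.prod_eq_single m (fun j _ hj => by simp [hj]) (by simp)]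
    simp
  rw [character_add_index, hs, hs, sub_eq_add_neg, mode_add, mode_neg]

/-- Collecting equal frequencies. -/
theorem exists_hasFourier_of_index {ι : Type*} {f : ℝ → ℂ} (k : ι → ℤ) (a : ι → ℂ)
    (ha : Summable fun i => ‖a i‖) (hf : ∀ x, HasSum (fun i => a i * mode (k i) x) (f x)) :
    ∃ b, HasFourier f b := by
  have hs : Summable fun p : Σ l : ℤ, {i // k i = l} => ‖a p.2‖ :=
    (Equiv.sigmaFiberEquiv k).summable_iff.mpr ha
  refine ⟨fun l => ∑' i : {i // k i = l}, a i, hs.of_norm.sigma, fun x => ?_⟩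
  have h1 : HasSum (fun p : Σ l : ℤ, {i // k i = l} => a p.2 * mode (k p.2) x) (f x) :=
    (Equiv.sigmaFiberEquiv k).hasSum_iff.mpr (hf x)
  refine h1.sigma fun l => ?_
  have h2 : Summable fun i : {i // k i = l} => a i := (ha.subtype _).of_norm
  refine (h2.hasSum.mul_right (mode l x)).congr_fun fun i => ?_
  rw [i.2]

open MeasureTheory in
theorem isFiniteMeasure_cube (n : ℕ) :
    IsFiniteMeasure ((volume : Measure (Fin n → ℝ)).restrict (cube n)) :=
  ⟨by rw [Measure.restrict_apply_univ]; exact isCompact_Icc.measure_lt_top⟩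

theorem volume_real_cube (n : ℕ) : (MeasureTheory.volume : MeasureTheory.Measure (Fin n → ℝ)).real (cube n) = 1 := by
  rw [MeasureTheory.measureReal_def, cube, Real.volume_Icc_pi]
  norm_num

/-- Termwise integration leaves only the frequency in the first variable and multiplies each
coefficient by an integral of modulus at most `1`, since the cube has volume `1`. -/
theorem AbsFourier.exists_hasFourier_integral {m : ℕ} {f : (Fin (m + 1) → ℝ) → ℂ}
    (hf : AbsFourier f) :
    ∃ b, HasFourier (fun x => ∫ y in cube m, f (Fin.cons x y : Fin (m + 1) → ℝ)) b := by
  obtain ⟨M, ι, hι, k, a, ha, -, h⟩ := hf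
  have := isFiniteMeasure_cube m
  have hv : ∀ i, ‖∫ y in cube m, character (fun j => k i j.succ) y‖ ≤ 1 := fun i => by
    refine (MeasureTheory.norm_setIntegral_le_of_norm_le_const (C := 1)
      isCompact_Icc.measure_lt_top fun y _ => by simp).trans ?_
    rw [← cube, volume_real_cube, mul_one]
  refine exists_hasFourier_of_index (fun i => k i 0)
    (fun i => a i * ∫ y in cube m, character (fun j => k i j.succ) y)
    (Summable.of_nonneg_of_le (fun _ => norm_nonneg _) (fun i => ?_) ha) fun x => ?_
  · rw [norm_mul]
    exact mul_le_of_le_one_right (norm_nonneg _) (hv i)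
  · have key : ∀ i (y : Fin m → ℝ), a i * character (k i) (Fin.cons x y : Fin (m + 1) → ℝ) =
        a i * mode (k i 0) x * character (fun j => k i j.succ) y := fun i y => by
      simp [character, Fin.prod_univ_succ, mul_assoc]
    have := MeasureTheory.hasSum_integral_of_summable_integral_norm
      (μ := MeasureTheory.volume.restrict (cube m))
      (F := fun i (y : Fin m → ℝ) => a i * character (k i) (Fin.cons x y : Fin (m + 1) → ℝ))
      (fun i => by
        simp only [key]
        exact ((continuous_character _).const_mul _).integrableOn_Icc) (by
        simpa [volume_real_cube, MeasureTheory.measureReal_restrict_apply_univ] using ha)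
    simp only [(h _).tsum_eq] at this
    refine this.congr_fun fun i => ?_
    simp only [key]
    rw [MeasureTheory.integral_const_mul]
    ring

theorem integral_mode (k : ℤ) :
    ∫ x in (-1 / 2 : ℝ)..(1 / 2), mode k x = if k = 0 then 1 else 0 := by
  split_ifs with hk
  · subst hk
    norm_num
  · have hc : (2 * Real.pi * Complex.I * k : ℂ) ≠ 0 := by
      simp [hk, Real.pi_ne_zero]
    unfold mode
    rw [integral_exp_mul_complex hc, div_eq_zero_iff, sub_eq_zero]
    left
    have := mode_periodic k (-1 / 2)
    norm_num [mode] at this ⊢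
    exact this

theorem HasFourier.integral_mul_mode {f : ℝ → ℂ} {a : ℤ → ℂ} (h : HasFourier f a) (l : ℤ) :
    ∫ x in (-1 / 2 : ℝ)..(1 / 2), f x * mode l x = a (-l) := by
  have h1 := intervalIntegral.hasSum_intervalIntegral_of_summable_norm (a := (-1 / 2 : ℝ)) (b := 1 / 2)
    (f := fun k => (⟨fun x => a k * mode k x * mode l x, by fun_prop⟩ : C(ℝ, ℂ))) (by
      refine Summable.of_nonneg_of_le (fun _ => norm_nonneg _) (fun k => ?_) h.summable.norm
      refine (ContinuousMap.norm_le _ (norm_nonneg _)).mpr fun x => by simp)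
  simp only [ContinuousMap.coe_mk] at h1
  have h2 : ∀ x, ∑' k, a k * mode k x * mode l x = f x * mode l x := fun x =>
    ((h.hasSum x).mul_right _).tsum_eq
  simp only [h2] at h1
  simp only [mul_assoc, ← mode_add_index, intervalIntegral.integral_const_mul,
    integral_mode] at h1
  refine h1.unique ((hasSum_ite_eq (-l) (a (-l))).congr_fun fun k => ?_)
  by_cases hk : k = -l
  · simp [hk]
  · have : k + l ≠ 0 := fun h0 => hk (by omega)
    simp [hk, this]

open MeasureTheory in
/-- Integration over a cube, one variable at a time. -/
theorem integral_cube_succ {m : ℕ} {f : (Fin (m + 1) → ℝ) → ℂ} (hf : Continuous f) :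
    ∫ z in cube (m + 1), f z =
      ∫ x in Set.Icc (-1 / 2 : ℝ) (1 / 2), ∫ y in cube m, f (Fin.cons x y : Fin (m + 1) → ℝ) := by
  have hmp := (volume_preserving_piFinSuccAbove (fun _ : Fin (m + 1) => ℝ) 0).symm
  have hpre : (MeasurableEquiv.piFinSuccAbove (fun _ : Fin (m + 1) => ℝ) 0).symm ⁻¹'
      cube (m + 1) = Set.Icc (-1 / 2 : ℝ) (1 / 2) ×ˢ cube m := by
    ext ⟨x, y⟩
    simp only [Set.mem_preimage, MeasurableEquiv.piFinSuccAbove_symm_apply, cube, Set.mem_Icc,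
      Pi.le_def, Set.mem_prod, Fin.forall_fin_succ, Fin.insertNthEquiv]
    simp
    tauto
  have h1 := hmp.setIntegral_preimage_emb
    (MeasurableEquiv.measurableEmbedding _) f (cube (m + 1))
  rw [hpre] at h1
  rw [← h1, Measure.volume_eq_prod, setIntegral_prod]
  · simp [MeasurableEquiv.piFinSuccAbove_symm_apply, Fin.insertNthEquiv]
  · refine ContinuousOn.integrableOn_compact (isCompact_Icc.prod isCompact_Icc) ?_
    refine (hf.comp ?_).continuousOn
    refine continuous_pi fun j => ?_
    refine Fin.cases ?_ (fun j => ?_) j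
    · simpa [MeasurableEquiv.piFinSuccAbove_symm_apply, Fin.insertNthEquiv] using continuous_fst
    · simp [MeasurableEquiv.piFinSuccAbove_symm_apply, Fin.insertNthEquiv]
      fun_prop

/-! ### Fourier series of smooth periodic functions -/

theorem hasDerivAt_mode (k : ℤ) (x : ℝ) :
    HasDerivAt (mode k) (2 * Real.pi * Complex.I * k * mode k x) x := by
  have h : HasDerivAt (fun y : ℝ => 2 * Real.pi * Complex.I * k * (y : ℂ))
      (2 * Real.pi * Complex.I * k) x := by
    simpa using (Complex.ofRealCLM.hasDerivAt (x := x)).const_mul (2 * Real.pi * Complex.I * k)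
  unfold mode
  convert h.cexp using 1
  ring

theorem integral_deriv_mul_mode {f f' : ℝ → ℂ} (hf : ∀ x, HasDerivAt f (f' x) x)
    (hf' : Continuous f') (hp : Function.Periodic f 1) (k : ℤ) :
    ∫ x in (-1 / 2 : ℝ)..(1 / 2), f' x * mode k x =
      -(2 * Real.pi * Complex.I * k) * ∫ x in (-1 / 2 : ℝ)..(1 / 2), f x * mode k x := by
  have hc : Continuous f := continuous_iff_continuousAt.mpr fun x => (hf x).continuousAt
  have h := intervalIntegral.integral_eq_sub_of_hasDerivAt (a := (-1 / 2 : ℝ)) (b := 1 / 2)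
    (fun x _ => (hf x).mul (hasDerivAt_mode k x)) (by
      apply Continuous.intervalIntegrable
      fun_prop)
  -- The boundary terms cancel by periodicity.
  have h0 : (f * mode k) (1 / 2 : ℝ) - (f * mode k) (-1 / 2 : ℝ) = 0 := by
    have := (hp.mul (mode_periodic k)) (-1 / 2)
    rw [sub_eq_zero, ← this]
    norm_num
  rw [h0, intervalIntegral.integral_add (by apply Continuous.intervalIntegrable; fun_prop)
    (by apply Continuous.intervalIntegrable; fun_prop)] at h
  rw [eq_neg_of_add_eq_zero_left h, neg_mul, ← intervalIntegral.integral_const_mul]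
  congr 2
  ext x
  ring

/-- Two integrations by parts give coefficients of size `O(k⁻²)`, hence summable; the series then
converges to `f` pointwise by the theory on `AddCircle`. -/
theorem exists_hasFourier_of_contDiff {f : ℝ → ℂ} (hf : ContDiff ℝ 2 f)
    (hp : Function.Periodic f 1) : ∃ a, HasFourier f a := by
  have hf1 : ContDiff ℝ 1 (deriv f) := by
    rw [show (2 : WithTop ℕ∞) = 1 + 1 by norm_num, contDiff_succ_iff_deriv] at hf
    exact hf.2.2
  have hd : ∀ x, HasDerivAt f (deriv f x) x := fun x =>
    (hf.differentiable (by norm_num) x).hasDerivAt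
  have hd1 : ∀ x, HasDerivAt (deriv f) (deriv (deriv f) x) x := fun x =>
    (hf1.differentiable (by norm_num) x).hasDerivAt
  have hc2 : Continuous (deriv (deriv f)) := hf1.continuous_deriv (by norm_num)
  have hp1 : Function.Periodic (deriv f) 1 := fun x => by
    have : (fun y => f (y + 1)) = f := funext hp
    rw [← deriv_comp_add_const, this]
  obtain ⟨B, hB⟩ := (isCompact_Icc (a := (-1 / 2 : ℝ)) (b := 1 / 2)).exists_bound_of_continuousOn
    hc2.continuousOn
  set a : ℤ → ℂ := fun k => ∫ x in (-1 / 2 : ℝ)..(1 / 2), f x * mode (-k) x with ha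
  have hbound : ∀ k : ℤ, ‖a k‖ * (k : ℝ) ^ 2 ≤ B := fun k => by
    have h1 := integral_deriv_mul_mode hd hf1.continuous hp (-k)
    have h2 := integral_deriv_mul_mode hd1 hc2 hp1 (-k)
    have h3 : ‖∫ x in (-1 / 2 : ℝ)..(1 / 2), deriv (deriv f) x * mode (-k) x‖ ≤ B := by
      refine (intervalIntegral.norm_integral_le_of_norm_le_const (C := B) fun x hx => ?_).trans ?_
      · rw [Set.uIoc_of_le (by norm_num)] at hx
        simpa using hB x ⟨hx.1.le, hx.2⟩
      · norm_num
    rw [h2, h1] at h3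
    simp only [norm_mul, norm_neg, Complex.norm_real, Complex.norm_I, Complex.norm_intCast,
      Int.cast_neg, Complex.norm_ofNat, Real.norm_eq_abs, abs_of_pos Real.pi_pos] at h3
    have h4 : ‖a k‖ * (k : ℝ) ^ 2 ≤ (2 * Real.pi) ^ 2 * (‖a k‖ * (k : ℝ) ^ 2) :=
      le_mul_of_one_le_left (by positivity) (by nlinarith [Real.pi_gt_three])
    refine h4.trans (le_of_eq_of_le ?_ h3)
    rw [← sq_abs (k : ℝ)]
    ring
  have hsum : Summable a := by
    refine Summable.of_norm_bounded_eventually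
      (((Real.summable_one_div_int_pow (p := 2)).mpr (by norm_num)).mul_left B) ?_
    filter_upwards [(Set.finite_singleton (0 : ℤ)).compl_mem_cofinite] with k hk
    have hk0 : (0 : ℝ) < (k : ℝ) ^ 2 := by
      have : (k : ℝ) ≠ 0 := by exact_mod_cast hk
      positivity
    rw [mul_one_div, le_div_iff₀ hk0]
    exact hbound k
  have hT : Fact ((0 : ℝ) < 1) := ⟨one_pos⟩
  have hlift : ∀ x : ℝ, hp.lift (x : AddCircle (1 : ℝ)) = f x := fun x => hp.lift_coe x
  let F : C(AddCircle (1 : ℝ), ℂ) := ⟨hp.lift, by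
    exact continuous_coinduced_dom.mpr hf.continuous⟩
  have hmode : ∀ (k : ℤ) (x : ℝ), fourier k (x : AddCircle (1 : ℝ)) = mode k x := fun k x => by
    simp [mode]
  have hco : ∀ k, fourierCoeff F k = a k := fun k => by
    rw [fourierCoeff_eq_intervalIntegral _ _ (-1 / 2)]
    simp only [hmode]
    norm_num
    simp only [ha, F]
    norm_num
    simp only [mul_comm]
  refine ⟨a, hsum, fun x => ?_⟩
  have := has_pointwise_sum_fourier_series_of_summable (f := F)
    (hsum.congr fun k => (hco k).symm) (x : AddCircle (1 : ℝ))
  simp only [hco, hmode, smul_eq_mul] at this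
  exact this

/-! ### Geometric bounds -/

/-- A Lambert-type series over `ℤ` converges in the annulus `|p| < |w| < 1`. -/
theorem summable_lambert {p w : ℂ} (hw1 : ‖w‖ < 1) (hpw : ‖p‖ < ‖w‖) (hp0 : p ≠ 0) :
    Summable fun n : ℤ => (1 - p ^ n)⁻¹ * w ^ n := by
  have hp1 : ‖p‖ < 1 := hpw.trans hw1
  have hw0 : w ≠ 0 := norm_pos_iff.mp ((norm_nonneg p).trans_lt hpw)
  have hC : ∀ n : ℕ, n ≠ 0 → ‖(1 - p ^ n)⁻¹‖ ≤ (1 - ‖p‖)⁻¹ := fun n hn => by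
    rw [norm_inv]
    apply inv_anti₀ (by linarith)
    have h1 : ‖p ^ n‖ ≤ ‖p‖ := by
      rw [norm_pow]
      exact pow_le_of_le_one (norm_nonneg _) hp1.le hn
    have h2 := norm_sub_norm_le (1 : ℂ) (p ^ n)
    rw [norm_one] at h2
    linarith
  have hC0 : 0 ≤ (1 - ‖p‖)⁻¹ := inv_nonneg.mpr (by linarith)
  apply Summable.of_nat_of_neg
  · refine Summable.of_norm_bounded ((summable_geometric_of_lt_one (norm_nonneg w) hw1).mul_left
      (1 - ‖p‖)⁻¹) fun n => ?_
    rcases eq_or_ne n 0 with rfl | hn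
    · simpa using hC0
    · rw [norm_mul, zpow_natCast, zpow_natCast, norm_pow w]
      gcongr
      exact hC n hn
  · have hr : ‖p / w‖ < 1 := by
      rw [norm_div]
      exact (div_lt_one (norm_pos_iff.mpr hw0)).mpr hpw
    refine Summable.of_norm_bounded ((summable_geometric_of_lt_one (norm_nonneg _) hr).mul_left
      (1 - ‖p‖)⁻¹) fun n => ?_
    rcases eq_or_ne n 0 with rfl | hn
    · simpa using hC0
    · have hpn : p ^ n ≠ 1 := fun h => by
        have h2 := pow_lt_one₀ (norm_nonneg p) hp1 hn
        rw [← norm_pow, h, norm_one] at h2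
        exact lt_irrefl _ h2
      have : (1 - p ^ (-(n : ℤ)))⁻¹ * w ^ (-(n : ℤ)) = -((1 - p ^ n)⁻¹ * (p / w) ^ n) := by
        have h1 : (1 - p ^ n) ≠ 0 := sub_ne_zero.mpr hpn.symm
        have h3 : p ^ n ≠ 0 := pow_ne_zero _ hp0
        have h4 : w ^ n ≠ 0 := pow_ne_zero _ hw0
        have h2 : (1 - (p ^ n)⁻¹) ≠ 0 := by
          rw [Ne, sub_eq_zero, eq_comm, inv_eq_one]
          exact hpn
        simp only [zpow_neg, zpow_natCast, div_pow]
        rw [show 1 - (p ^ n)⁻¹ = -(1 - p ^ n) / p ^ n by field_simp; ring]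
        field_simp
      rw [this, norm_neg, norm_mul, norm_pow]
      gcongr
      exact hC n hn

/-! ### The theta function -/

/-- The Laurent coefficients `(-1)^m p^{m(m+1)/2}` of the theta function. -/
def thetaCoeff (δ : ℂ) (m : ℤ) : ℂ :=
  (-1) ^ m * Complex.exp (Real.pi * Complex.I * δ * (m * (m + 1)))

theorem thetaCoeff_succ (δ : ℂ) (m : ℤ) :
    thetaCoeff δ (m + 1) =
      -(Complex.exp (2 * Real.pi * Complex.I * δ) ^ (m + 1) * thetaCoeff δ m) := by
  have h : Complex.exp (Real.pi * Complex.I * δ * (((m + 1 : ℤ) : ℂ) * (((m + 1 : ℤ) : ℂ) + 1))) =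
      Complex.exp (2 * Real.pi * Complex.I * δ) ^ (m + 1) *
        Complex.exp (Real.pi * Complex.I * δ * (m * (m + 1))) := by
    rw [← Complex.exp_int_mul, ← Complex.exp_add]
    congr 1
    push_cast
    ring
  rw [thetaCoeff, thetaCoeff, h, zpow_add_one₀ (by norm_num)]
  ring

theorem thetaCoeff_reflect (δ : ℂ) (m : ℤ) : thetaCoeff δ (-1 - m) = -thetaCoeff δ m := by
  have h : ((-1 : ℂ)) ^ (-1 - m) = -(-1) ^ m := by
    rw [zpow_sub₀ (by norm_num)]
    rcases Int.even_or_odd m with hm | hm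
    · simp [hm.neg_one_zpow]
    · simp [hm.neg_one_zpow]
  rw [thetaCoeff, thetaCoeff, h, neg_mul]
  congr 3
  push_cast
  ring

/-- The shift by `δ/2 + 1/2` turns the even Jacobi theta series into the odd one, so that the
differentiability and derivative formulas for `jacobiTheta₂` apply to `theta1`. -/
theorem jacobiTheta₂_term_eq (δ x : ℂ) (m : ℤ) :
    jacobiTheta₂_term m (x + δ / 2 + 1 / 2) δ =
      thetaCoeff δ m * Complex.exp (2 * Real.pi * Complex.I * x) ^ m := by
  rw [jacobiTheta₂_term, thetaCoeff, ← Complex.exp_int_mul, ← Complex.exp_pi_mul_I,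
    ← Complex.exp_int_mul, ← Complex.exp_add, ← Complex.exp_add]
  congr 1
  ring

theorem theta1_eq (δ x : ℂ) : theta1 δ x = -Complex.I * Complex.exp (Real.pi * Complex.I * δ / 4) *
    Complex.exp (Real.pi * Complex.I * x) * jacobiTheta₂ (x + δ / 2 + 1 / 2) δ := by
  rw [theta1, jacobiTheta₂]
  congr 1
  refine tsum_congr fun m => ?_
  rw [jacobiTheta₂_term_eq, thetaCoeff, ← Complex.exp_int_mul, mul_assoc ((-1 : ℂ) ^ m),
    ← Complex.exp_add]
  congr 2
  ring

theorem differentiable_theta1 {δ : ℂ} (hδ : 0 < δ.im) : Differentiable ℂ (theta1 δ) := by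
  rw [show theta1 δ = _ from funext (theta1_eq δ)]
  have h : Differentiable ℂ fun x : ℂ => jacobiTheta₂ (x + δ / 2 + 1 / 2) δ := fun x =>
    (differentiableAt_jacobiTheta₂_fst (x + δ / 2 + 1 / 2) hδ).comp x
      (f := fun x : ℂ => x + δ / 2 + 1 / 2) (by fun_prop)
  fun_prop

theorem theta1_add_one (δ x : ℂ) : theta1 δ (x + 1) = -theta1 δ x := by
  rw [theta1_eq, theta1_eq, show x + 1 + δ / 2 + 1 / 2 = (x + δ / 2 + 1 / 2) + 1 by ring,
    jacobiTheta₂_add_left, mul_add, Complex.exp_add, mul_one,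
    Complex.exp_pi_mul_I]
  ring

theorem theta1_neg (δ x : ℂ) : theta1 δ (-x) = -theta1 δ x := by
  rw [theta1, theta1, ← (Equiv.subLeft (-1 : ℤ)).tsum_eq, ← tsum_mul_left, ← tsum_mul_left,
    ← tsum_neg]
  refine tsum_congr fun m => ?_
  have h := thetaCoeff_reflect δ m
  simp only [thetaCoeff] at h
  rw [Equiv.subLeft_apply, Complex.exp_add, Complex.exp_add, ← mul_assoc ((-1 : ℂ) ^ _), h,
    ← mul_assoc ((-1 : ℂ) ^ _)]
  have h2 : Complex.exp (Real.pi * Complex.I * -x) *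
      Complex.exp (2 * Real.pi * Complex.I * ((-1 - m : ℤ) : ℂ) * -x) =
      Complex.exp (Real.pi * Complex.I * x) * Complex.exp (2 * Real.pi * Complex.I * m * x) := by
    rw [← Complex.exp_add, ← Complex.exp_add]
    congr 1
    push_cast
    ring
  linear_combination (Complex.I * Complex.exp (Real.pi * Complex.I * δ / 4) * ((-1 : ℂ) ^ m *
    Complex.exp (Real.pi * Complex.I * δ * (m * (m + 1))))) * h2

theorem summable_thetaCoeff_mul {δ : ℂ} (hδ : 0 < δ.im) (x : ℂ) :
    Summable fun m : ℤ => thetaCoeff δ m * Complex.exp (2 * Real.pi * Complex.I * x) ^ m :=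
  ((summable_jacobiTheta₂_term_iff (x + δ / 2 + 1 / 2) δ).mpr hδ).congr fun m =>
    (jacobiTheta₂_term_eq δ x m)

/-- This is the zero of `ϑ₁` at the origin: the reflection `m ↦ -1 - m` changes the sign of every
coefficient, so the sum equals its own negative. -/
theorem hasSum_thetaCoeff {δ : ℂ} (hδ : 0 < δ.im) : HasSum (thetaCoeff δ) 0 := by
  have h : Summable (thetaCoeff δ) := by simpa using summable_thetaCoeff_mul hδ 0
  have h1 := (Equiv.subLeft (-1 : ℤ)).hasSum_iff.mpr h.hasSum
  have h2 : thetaCoeff δ ∘ Equiv.subLeft (-1 : ℤ) = fun m => -thetaCoeff δ m :=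
    funext fun m => thetaCoeff_reflect δ m
  rw [h2] at h1
  have h3 : ∑' m, thetaCoeff δ m = -∑' m, thetaCoeff δ m := h1.unique h.hasSum.neg
  have h4 : ∑' m, thetaCoeff δ m = 0 := self_eq_neg.mp h3
  exact h4 ▸ h.hasSum

/-- Convolution of the theta coefficients with those of the Lambert series. -/
theorem thetaCoeff_convolution {δ : ℂ} (hδ : 0 < δ.im) {p : ℂ}
    (hp : p = Complex.exp (2 * Real.pi * Complex.I * δ)) {s : ℤ → ℂ}
    (hs : ∀ N, HasSum (fun m => thetaCoeff δ m * (1 - p ^ (N - m))⁻¹) (s N)) (N : ℤ) :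
    s N = thetaCoeff δ N * (s 0 - N) := by
  have hp0 : p ≠ 0 := hp ▸ Complex.exp_ne_zero _
  have hpn : ∀ n : ℤ, n ≠ 0 → 1 - p ^ n ≠ 0 := fun n hn h => by
    have h1 : ‖p ^ n‖ = 1 := by rw [← sub_eq_zero.mp h, norm_one]
    rw [hp, ← Complex.exp_int_mul, Complex.norm_exp, Real.exp_eq_one_iff] at h1
    simp [hn, Real.pi_ne_zero, hδ.ne'] at h1
  have hstep : ∀ N, s (N + 1) = p ^ (N + 1) * (thetaCoeff δ N - s N) := fun N => by
    have h1 := (Equiv.addRight (1 : ℤ)).hasSum_iff.mpr (hs (N + 1))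
    have h2 := (Equiv.addRight (1 : ℤ)).hasSum_iff.mpr (hasSum_thetaCoeff hδ)
    -- From `p^(m+1) = p^(m+1) (1 - p^(N-m)) + p^(N+1)`, each term with `m ≠ N` splits into a theta
    -- coefficient, whose total is zero, and a multiple of a term of `s N`. At `m = N` the inverse
    -- is `0⁻¹ = 0`, and the single extra term restores the balance.
    have h3 := (h2.sub ((hs N).mul_left (p ^ (N + 1)))).add
      (hasSum_ite_eq N (p ^ (N + 1) * thetaCoeff δ N))
    refine (h1.unique (h3.congr_fun fun m => ?_)).trans (by ring)
    simp only [Function.comp_apply, Equiv.coe_addRight, thetaCoeff_succ δ m, ← hp]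
    rw [show N + 1 - (m + 1) = N - m by ring]
    split_ifs with hm
    · subst hm
      simp
    · have h4 := hpn (N - m) (by omega)
      have h5 : p ^ (m + 1) * p ^ (N - m) = p ^ (N + 1) := by
        rw [← zpow_add₀ hp0]
        congr 1
        ring
      rw [← h5]
      field_simp
      ring
  have hA0 : thetaCoeff δ 0 = 1 := by simp [thetaCoeff]
  have hsucc : ∀ N, thetaCoeff δ (N + 1) = -(p ^ (N + 1) * thetaCoeff δ N) := fun N => by
    rw [thetaCoeff_succ, hp]
  induction N using Int.induction_on with
  | zero => simp [hA0]
  | succ i ih =>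
    rw [hstep, ih, hsucc]
    push_cast
    ring
  | pred i ih =>
    have h1 := hstep (-(i : ℤ) - 1)
    have h2 := hsucc (-(i : ℤ) - 1)
    rw [sub_add_cancel] at h1 h2
    rw [ih, h2] at h1
    have h3 : p ^ (-(i : ℤ)) ≠ 0 := zpow_ne_zero _ hp0
    rw [neg_mul, mul_assoc, ← mul_neg, mul_right_inj' h3] at h1
    push_cast at h1 ⊢
    linear_combination h1

/-- The logarithmic derivative of the theta function is a Lambert series. -/
theorem jacobiTheta₂'_eq_mul {δ : ℂ} (hδ : 0 < δ.im) : ∃ u : ℂ, ∀ x : ℂ, 0 < x.im → x.im < δ.im →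
    jacobiTheta₂' (x + δ / 2 + 1 / 2) δ = 2 * Real.pi * Complex.I *
      (u - ∑' n : ℤ, (1 - Complex.exp (2 * Real.pi * Complex.I * δ) ^ n)⁻¹ *
        Complex.exp (2 * Real.pi * Complex.I * x) ^ n) * jacobiTheta₂ (x + δ / 2 + 1 / 2) δ := by
  set p := Complex.exp (2 * Real.pi * Complex.I * δ) with hp
  -- The constant is `s 0` of `thetaCoeff_convolution`, which does not depend on `x`. The term `n =
  -- 0` of the Lambert series is zero because `0⁻¹ = 0`.
  refine ⟨∑' m, thetaCoeff δ m * (1 - p ^ (0 - m))⁻¹, fun x hx hxδ => ?_⟩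
  set w := Complex.exp (2 * Real.pi * Complex.I * x) with hw
  have hnorm : ∀ z : ℂ, ‖Complex.exp (2 * Real.pi * Complex.I * z)‖ =
      Real.exp (-(2 * Real.pi * z.im)) := fun z => by
    simp [Complex.norm_exp]
  have hw1 : ‖w‖ < 1 := by
    rw [hw, hnorm, Real.exp_lt_one_iff]
    nlinarith [Real.pi_pos]
  have hpw : ‖p‖ < ‖w‖ := by
    rw [hw, hp, hnorm, hnorm, Real.exp_lt_exp]
    nlinarith [Real.pi_pos]
  have hw0 : w ≠ 0 := Complex.exp_ne_zero _
  have hL := summable_lambert hw1 hpw (Complex.exp_ne_zero _)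
  have hA := summable_thetaCoeff_mul hδ x
  have hprod := summable_mul_of_summable_norm hA.norm hL.norm
  -- Collects the product of the two Laurent series by total degree `N`: the pair `(N, m)` goes to
  -- the exponents `m` and `N - m`.
  let e : ℤ × ℤ ≃ ℤ × ℤ :=
    { toFun := fun q => (q.2, q.1 - q.2)
      invFun := fun q => (q.1 + q.2, q.1)
      left_inv := fun q => by simp
      right_inv := fun q => by simp }
  have hprod' := e.summable_iff.mpr hprod
  have hterm : ∀ q : ℤ × ℤ, ((fun q : ℤ × ℤ => thetaCoeff δ q.1 * w ^ q.1 *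
      ((1 - p ^ q.2)⁻¹ * w ^ q.2)) ∘ e) q =
      thetaCoeff δ q.2 * (1 - p ^ (q.1 - q.2))⁻¹ * w ^ q.1 := fun q => by
    simp only [Function.comp_apply, e, Equiv.coe_fn_mk]
    rw [zpow_sub₀ hw0]
    field_simp
  have hfib : ∀ N, Summable fun m => thetaCoeff δ m * (1 - p ^ (N - m))⁻¹ := fun N => by
    have h := (hprod'.prod_factor N).congr fun m => hterm (N, m)
    exact (summable_mul_right_iff (zpow_ne_zero N hw0)).mp h
  have hconv := thetaCoeff_convolution hδ hp (fun N => (hfib N).hasSum)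
  have hsum := (hA.hasSum.mul hL.hasSum hprod)
  rw [← e.hasSum_iff] at hsum
  have h1 := (hsum.congr_fun fun q => (hterm q).symm).prod_fiberwise fun N => (hfib N).hasSum.mul_right (w ^ N)
  have hΘ : ∑' m, thetaCoeff δ m * w ^ m = jacobiTheta₂ (x + δ / 2 + 1 / 2) δ :=
    tsum_congr fun m => (jacobiTheta₂_term_eq δ x m).symm
  have h2 := ((hasSum_jacobiTheta₂_term (x + δ / 2 + 1 / 2) hδ).mul_left
    (∑' m, thetaCoeff δ m * (1 - p ^ (0 - m))⁻¹)).sub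
    ((hasSum_jacobiTheta₂'_term (x + δ / 2 + 1 / 2) hδ).mul_left (2 * Real.pi * Complex.I)⁻¹)
  have hpi : (2 * Real.pi * Complex.I : ℂ) ≠ 0 := Complex.two_pi_I_ne_zero
  have h3 := h1.unique (h2.congr_fun fun N => by
    have : jacobiTheta₂'_term N (x + δ / 2 + 1 / 2) δ =
        2 * Real.pi * Complex.I * N * jacobiTheta₂_term N (x + δ / 2 + 1 / 2) δ := rfl
    rw [hconv N, this, jacobiTheta₂_term_eq, ← hw]
    field_simp)
  rw [hΘ] at h3
  have h4 := mul_inv_cancel₀ hpi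
  linear_combination (2 * Real.pi * Complex.I) * h3 - jacobiTheta₂' (x + δ / 2 + 1 / 2) δ * h4

/-- On a horizontal line in the strip, theta solves a linear ODE `f' = M f` with `M` bounded, by the
Lambert series. A single zero would make it vanish on the whole line, contradicting its nonzero
Fourier coefficients. -/
theorem jacobiTheta₂_ne_zero {δ x : ℂ} (hx : 0 < x.im) (hxδ : x.im < δ.im) :
    jacobiTheta₂ (x + δ / 2 + 1 / 2) δ ≠ 0 := by
  have hδ := hx.trans hxδ
  intro h0
  obtain ⟨u, hu⟩ := jacobiTheta₂'_eq_mul hδ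
  set p := Complex.exp (2 * Real.pi * Complex.I * δ) with hp
  have hnorm : ∀ z : ℂ, ‖Complex.exp (2 * Real.pi * Complex.I * z)‖ =
      Real.exp (-(2 * Real.pi * z.im)) := fun z => by
    simp [Complex.norm_exp]
  set f : ℝ → ℂ := fun t => jacobiTheta₂ ((x + t) + δ / 2 + 1 / 2) δ with hf
  set M : ℝ → ℂ := fun t => 2 * Real.pi * Complex.I *
    (u - ∑' n : ℤ, (1 - p ^ n)⁻¹ * Complex.exp (2 * Real.pi * Complex.I * (x + t)) ^ n) with hM
  have hd : ∀ t, HasDerivAt f (M t * f t) t := fun t => by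
    have h1 := hasDerivAt_jacobiTheta₂_fst ((x + t) + δ / 2 + 1 / 2) hδ
    rw [hu (x + t) (by simpa using hx) (by simpa using hxδ)] at h1
    have h2 : HasDerivAt (fun t : ℝ => (x + t) + δ / 2 + 1 / 2) 1 t := by
      simpa using ((((Complex.ofRealCLM.hasDerivAt (x := t)).const_add x).add_const
        (δ / 2)).add_const (1 / 2))
    have h3 := h1.comp t h2
    rw [mul_one] at h3
    exact h3
  set B : ℝ := 2 * Real.pi * (‖u‖ +
    ∑' n : ℤ, ‖(1 - p ^ n)⁻¹ * Complex.exp (2 * Real.pi * Complex.I * x) ^ n‖) with hB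
  have hMB : ∀ t, ‖M t‖ ≤ B := fun t => by
    have h1 : ∀ n : ℤ, ‖(1 - p ^ n)⁻¹ * Complex.exp (2 * Real.pi * Complex.I * (x + t)) ^ n‖ =
        ‖(1 - p ^ n)⁻¹ * Complex.exp (2 * Real.pi * Complex.I * x) ^ n‖ := fun n => by
      rw [norm_mul, norm_mul, norm_zpow _ n, norm_zpow _ n, hnorm, hnorm]
      simp
    have h2 : Summable fun n : ℤ =>
        ‖(1 - p ^ n)⁻¹ * Complex.exp (2 * Real.pi * Complex.I * x) ^ n‖ := by
      refine (summable_lambert ?_ ?_ (Complex.exp_ne_zero _)).norm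
      · rw [hnorm, Real.exp_lt_one_iff]
        nlinarith [Real.pi_pos]
      · rw [hnorm, hnorm, Real.exp_lt_exp]
        nlinarith [Real.pi_pos]
    have h3 := norm_tsum_le_tsum_norm (h2.congr fun n => (h1 n).symm)
    simp only [h1] at h3
    rw [hM, norm_mul, hB]
    refine mul_le_mul (by simp [abs_of_pos Real.pi_pos]) ((norm_sub_le _ _).trans ?_)
      (norm_nonneg _) (by positivity)
    gcongr
  have hB0 : 0 ≤ B := (norm_nonneg _).trans (hMB 0)
  have hzero : f = fun _ => 0 := by
    refine ODE_solution_unique_univ (v := fun t y => M t * y) (s := fun _ => Set.univ)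
      (K := ⟨B, hB0⟩) (t₀ := 0) (fun t => ?_) (fun t => ⟨hd t, trivial⟩)
      (fun t => ⟨by simpa using hasDerivAt_const t (0 : ℂ), trivial⟩) (by simpa [hf] using h0)
    refine (LipschitzWith.of_dist_le_mul fun y z => ?_).lipschitzOnWith
    rw [dist_eq_norm, dist_eq_norm, ← mul_sub, norm_mul]
    exact mul_le_mul_of_nonneg_right (hMB t) (norm_nonneg _)
  have hF : HasFourier f fun m => thetaCoeff δ m * Complex.exp (2 * Real.pi * Complex.I * x) ^ m :=
    ⟨summable_thetaCoeff_mul hδ x, fun t => by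
      refine (hasSum_jacobiTheta₂_term ((x + t) + δ / 2 + 1 / 2) hδ).congr_fun fun m => ?_
      rw [jacobiTheta₂_term_eq, mul_add, Complex.exp_add, mul_zpow, mode,
        ← Complex.exp_int_mul _ m, ← Complex.exp_int_mul _ m, mul_assoc]
      congr 3
      ring⟩
  -- The coefficient of index `0` is `thetaCoeff δ 0 = 1`.
  have := hF.integral_mul_mode 0
  rw [hzero] at this
  simp [thetaCoeff] at this

theorem theta1_ne_zero {δ x : ℂ} (hx : 0 < x.im) (hxδ : x.im < δ.im) : theta1 δ x ≠ 0 := by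
  rw [theta1_eq]
  exact mul_ne_zero (mul_ne_zero (mul_ne_zero (neg_ne_zero.mpr Complex.I_ne_zero)
    (Complex.exp_ne_zero _)) (Complex.exp_ne_zero _)) (jacobiTheta₂_ne_zero hx hxδ)

/-! ### The pair kernel -/

/-- The factor `ϑ₁(x)² / (ϑ₁(x+γ) ϑ₁(x-γ))` of the pair kernel. -/
def pairFactor (δ γ : ℂ) (x : ℝ) : ℂ :=
  theta1 δ x ^ 2 / (theta1 δ (x + γ) * theta1 δ (x - γ))

theorem pairFactor_neg (δ γ : ℂ) (x : ℝ) : pairFactor δ γ (-x) = pairFactor δ γ x := by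
  rw [pairFactor, pairFactor, show ((-x : ℝ) : ℂ) + γ = -(x - γ) by push_cast; ring,
    show ((-x : ℝ) : ℂ) - γ = -(x + γ) by push_cast; ring, Complex.ofReal_neg,
    theta1_neg, theta1_neg, theta1_neg]
  ring_nf

/-- The denominator does not vanish for real `x`, because `x + γ` and `γ - x` lie in the strip where
`theta1_ne_zero` applies. The sign changes of `ϑ₁` under `x ↦ x + 1` cancel in the quotient. -/
theorem exists_hasFourier_pairFactor {δ γ : ℂ} (hγ : 0 < γ.im) (hγδ : γ.im < δ.im) :
    ∃ a, HasFourier (pairFactor δ γ) a := by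
  have hc : ContDiff ℝ 2 (theta1 δ) :=
    (differentiable_theta1 (hγ.trans hγδ)).contDiff.restrict_scalars ℝ
  have hx : ContDiff ℝ 2 fun x : ℝ => (x : ℂ) := Complex.ofRealCLM.contDiff
  refine exists_hasFourier_of_contDiff ?_ fun x => ?_
  · unfold pairFactor
    have h1 : ContDiff ℝ 2 fun x : ℝ => theta1 δ x := hc.comp hx
    have h2 : ContDiff ℝ 2 fun x : ℝ => theta1 δ (x + γ) := hc.comp (hx.add contDiff_const)
    have h3 : ContDiff ℝ 2 fun x : ℝ => theta1 δ (x - γ) := hc.comp (hx.sub contDiff_const)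
    simp only [div_eq_mul_inv]
    refine (h1.pow 2).mul ((h2.mul h3).inv fun x => mul_ne_zero ?_ ?_)
    · exact theta1_ne_zero (by simpa using hγ) (by simpa using hγδ)
    · show theta1 δ (x - γ) ≠ 0
      rw [← neg_sub, theta1_neg]
      exact neg_ne_zero.mpr (theta1_ne_zero (by simpa using hγ) (by simpa using hγδ))
  · simp only [pairFactor]
    rw [show ((x + 1 : ℝ) : ℂ) + γ = (x + γ) + 1 by push_cast; ring,
      show ((x + 1 : ℝ) : ℂ) - γ = (x - γ) + 1 by push_cast; ring,
      show ((x + 1 : ℝ) : ℂ) = x + 1 by push_cast; ring,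
      theta1_add_one, theta1_add_one, theta1_add_one]
    ring

theorem pairKernel_eq {δ γ : ℂ} {n : ℕ} (x : Fin n → ℝ) :
    pairKernel δ γ x = ∏ i : Fin n, ∏ j ∈ Finset.Ioi i, pairFactor δ γ (x i - x j) := by
  simp [pairKernel, pairFactor]

theorem absFourier_pairKernel {δ γ : ℂ} (hγ : 0 < γ.im) (hγδ : γ.im < δ.im) (n : ℕ) :
    AbsFourier fun x : Fin n → ℝ => pairKernel δ γ x := by
  obtain ⟨a, ha⟩ := exists_hasFourier_pairFactor hγ hγδ
  simp only [pairKernel_eq]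
  exact AbsFourier.prod _ fun i _ => AbsFourier.prod _ fun j _ => ha.comp_sub i j

/-- Reduced to the known rule for antisymmetric functions: multiply `f` by the antisymmetric
`±1`-valued `g`, apply the rule to `f * g` and to `g`, and cancel the sign of `σ`. -/
theorem prod_Ioi_comp_perm {n : ℕ} (σ : Equiv.Perm (Fin n)) {f : Fin n → Fin n → ℂ}
    (hf : ∀ i j, f i j = f j i) :
    ∏ i, ∏ j ∈ Finset.Ioi i, f (σ i) (σ j) = ∏ i, ∏ j ∈ Finset.Ioi i, f i j := by
  let g : Fin n → Fin n → ℂ := fun i j => if i < j then 1 else if j < i then -1 else 0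
  have hg : ∀ i j, g i j = -g j i := fun i j => by
    rcases lt_trichotomy i j with h | h | h
    · simp [g, h, h.not_gt]
    · simp [g, h]
    · simp [g, h, h.not_gt]
  have h1 := σ.prod_Ioi_comp_eq_sign_mul_prod (f := fun i j => f i j * g i j) fun i j => by
    rw [hg, hf]; ring
  have h2 := σ.prod_Ioi_comp_eq_sign_mul_prod hg
  have h3 : ∏ i, ∏ j ∈ Finset.Ioi i, g i j = 1 :=
    Finset.prod_eq_one fun i _ => Finset.prod_eq_one fun j hj => by
      simp [g, Finset.mem_Ioi.mp hj]
  simp only [Finset.prod_mul_distrib] at h1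
  rw [h2, h3, mul_one, mul_one, mul_comm] at h1
  refine mul_left_cancel₀ ?_ h1
  exact_mod_cast (Equiv.Perm.sign σ).ne_zero

theorem pairKernel_comp_perm {δ γ : ℂ} {n : ℕ} (σ : Equiv.Perm (Fin n)) (x : Fin n → ℝ) :
    pairKernel δ γ (fun i => x (σ i)) = pairKernel δ γ x := by
  rw [pairKernel_eq, pairKernel_eq]
  refine prod_Ioi_comp_perm σ (f := fun i j => pairFactor δ γ (x i - x j)) fun i j => ?_
  rw [← pairFactor_neg, neg_sub]

/-! ### The kernel of the singular integral operator -/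

/-- Once summability over `ℤ` is known, the value may be computed from the pairs `±n`, the form in
which the cotangent expansion is available. -/
theorem hasSum_int_of_pairs {f : ℤ → ℂ} (hf : Summable f) {b : ℂ}
    (hb : HasSum (fun n : ℕ => f (n + 1) + f (-(n + 1))) b) : HasSum f (f 0 + b) := by
  have h1 := hf.hasSum.nat_add_neg
  have h2 : HasSum (fun n : ℕ => f n + f (-n)) ((f 0 + f 0) + b) := by
    have := HasSum.zero_add (f := fun n : ℕ => f n + f (-n)) (m := b) (by exact_mod_cast hb)
    simpa using this
  have h3 := h1.unique h2
  have h4 : ∑' n, f n = f 0 + b := by linear_combination h3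
  exact h4 ▸ hf.hasSum

/-- `π cot(πz)`. -/
def cotPi (z : ℂ) : ℂ := Real.pi * Complex.cot (Real.pi * z)

theorem cotPi_neg (z : ℂ) : cotPi (-z) = -cotPi z := by
  simp [cotPi, Complex.cot, div_neg]

theorem hasSum_cotPi {z : ℂ} (hz : ∀ n : ℤ, z ≠ n) :
    HasSum (fun n : ℕ => 1 / (z - (n + 1)) + 1 / (z + (n + 1))) (cotPi z - 1 / z) := by
  have hz' : z ∈ Complex.integerComplement := fun ⟨n, hn⟩ => hz n hn.symm
  rw [cotPi, cot_series_rep' hz']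
  exact (summable_cotTerm hz').hasSum

theorem hasSum_cotPi_geometric {z : ℂ} (hz : 0 < z.im) :
    HasSum (fun k : ℕ => -(2 * Real.pi * Complex.I) *
      Complex.exp (2 * Real.pi * Complex.I * z) ^ (k + 1)) (cotPi z + Real.pi * Complex.I) := by
  have hw : ‖Complex.exp (2 * Real.pi * Complex.I * z)‖ < 1 :=
    UpperHalfPlane.norm_exp_two_pi_I_lt_one ⟨z, hz⟩
  have h := pi_mul_cot_pi_q_exp ⟨z, hz⟩
  rw [UpperHalfPlane.coe_mk, tsum_geometric_of_norm_lt_one hw] at h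
  have h1 : (1 - Complex.exp (2 * Real.pi * Complex.I * z)) ≠ 0 := fun h0 => by
    rw [← sub_eq_zero.mp h0, norm_one] at hw
    exact lt_irrefl _ hw
  have h2 := ((hasSum_geometric_of_norm_lt_one hw).mul_right
    (Complex.exp (2 * Real.pi * Complex.I * z))).mul_left (-(2 * Real.pi * Complex.I))
  have h3 : cotPi z + Real.pi * Complex.I = -(2 * Real.pi * Complex.I) *
      ((1 - Complex.exp (2 * Real.pi * Complex.I * z))⁻¹ *
        Complex.exp (2 * Real.pi * Complex.I * z)) := by
    rw [cotPi, h]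
    linear_combination (-(2 * Real.pi * Complex.I)) * mul_inv_cancel₀ h1
  rw [h3]
  simpa only [pow_succ] using h2

theorem laplacian_cotPi_neg (γ z : ℂ) :
    discreteLaplacian γ cotPi (-z) = -discreteLaplacian γ cotPi z := by
  rw [discreteLaplacian, discreteLaplacian, show -z - γ = -(z + γ) by ring,
    show -z + γ = -(z - γ) by ring, cotPi_neg, cotPi_neg, cotPi_neg]
  ring

/-- The lattice point `m + nδ`. -/
def normLattice (δ : ℂ) (mn : ℤ × ℤ) : ℂ := mn.1 + mn.2 * δ

theorem normLattice_ne_zero {δ : ℂ} (hδ : 0 < δ.im) {mn : ℤ × ℤ} (h : mn ≠ 0) :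
    normLattice δ mn ≠ 0 := fun h0 => by
  have him := congrArg Complex.im h0
  have hre := congrArg Complex.re h0
  simp only [normLattice, Complex.add_im, Complex.intCast_im, Complex.mul_im, Complex.intCast_re,
    Complex.zero_im, zero_mul, zero_add, add_zero, mul_eq_zero, Int.cast_eq_zero, hδ.ne',
    or_false] at him
  simp [normLattice, him] at hre
  exact h (Prod.ext hre him)

theorem summable_normLattice_inv_cube {δ : ℂ} (hδ : 0 < δ.im) :
    Summable fun mn : ℤ × ℤ => ‖(normLattice δ mn)⁻¹‖ ^ 3 := by
  have h := EisensteinSeries.summable_norm_eisSummand (k := 3) le_rfl ⟨δ, hδ⟩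
  let e : ℤ × ℤ ≃ (Fin 2 → ℤ) := (Equiv.prodComm ℤ ℤ).trans (finTwoArrowEquiv ℤ).symm
  refine (e.summable_iff.mpr h).congr fun mn => ?_
  simp only [Function.comp_apply, EisensteinSeries.eisSummand, normLattice, e, Equiv.trans_apply,
    Equiv.prodComm_apply, finTwoArrowEquiv_symm_apply, Prod.fst_swap, Prod.snd_swap,
    Matrix.cons_val_zero, Matrix.cons_val_one]
  rw [zpow_neg, norm_inv, norm_inv, inv_pow, add_comm, norm_zpow]
  norm_cast

/-- The term equals `w² / (l² (w - l))`, which is at most `2 |w|² |l|⁻³` as soon as `|l| > 2 |w|`;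
this excludes only finitely many lattice points. -/
theorem summable_zeta_terms {δ : ℂ} (hδ : 0 < δ.im) (w : ℂ) :
    Summable fun mn : {mn : ℤ × ℤ // mn ≠ 0} => 1 / (w - normLattice δ mn) +
      1 / normLattice δ mn + w / normLattice δ mn ^ 2 := by
  have hs : Summable fun mn : {mn : ℤ × ℤ // mn ≠ 0} => ‖(normLattice δ mn)⁻¹‖ ^ 3 :=
    (summable_normLattice_inv_cube hδ).subtype _
  have hpos : (0 : ℝ) < (2 * ‖w‖ + 1)⁻¹ ^ 3 := by positivity
  refine Summable.of_norm_bounded_eventually (hs.mul_left (2 * ‖w‖ ^ 2)) ?_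
  filter_upwards [hs.tendsto_cofinite_zero.eventually (gt_mem_nhds hpos)] with mn hmn
  have hl := normLattice_ne_zero hδ mn.2
  set l := normLattice δ mn with hldef
  have hl0 : 0 < ‖l‖ := norm_pos_iff.mpr hl
  have h1 : 2 * ‖w‖ < ‖l‖ := by
    have := lt_of_pow_lt_pow_left₀ 3 (by positivity) hmn
    rw [norm_inv, inv_lt_inv₀ hl0 (by positivity)] at this
    linarith
  have h2 : ‖l‖ / 2 ≤ ‖w - l‖ := by
    have := norm_sub_norm_le l w
    rw [norm_sub_rev] at this
    linarith
  have h3 : w - l ≠ 0 := norm_pos_iff.mp (by linarith)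
  have h4 : 1 / (w - l) + 1 / l + w / l ^ 2 = w ^ 2 * l⁻¹ ^ 2 * (w - l)⁻¹ := by
    field_simp
    ring
  rw [h4, norm_mul, norm_mul, norm_pow, norm_pow, norm_inv, norm_inv]
  calc ‖w‖ ^ 2 * ‖l‖⁻¹ ^ 2 * ‖w - l‖⁻¹ ≤ ‖w‖ ^ 2 * ‖l‖⁻¹ ^ 2 * (‖l‖ / 2)⁻¹ := by
        gcongr
    _ = 2 * ‖w‖ ^ 2 * ‖l‖⁻¹ ^ 3 := by
        rw [inv_div]
        field_simp

theorem hasSum_weierstrassZeta {ω₁ ω₂ δ : ℂ} (hδ : δ = ω₂ / ω₁) (hδ_pos : 0 < δ.im) (w : ℂ) :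
    HasSum (fun mn : {mn : ℤ × ℤ // mn ≠ 0} => 1 / (w - normLattice δ mn) +
      1 / normLattice δ mn + w / normLattice δ mn ^ 2)
      (2 * ω₁ * weierstrassZeta ω₁ ω₂ (2 * ω₁ * w) - 1 / w) := by
  have hω : ω₁ ≠ 0 := fun h => by simp [hδ, h] at hδ_pos
  have hω₂ : ω₂ = δ * ω₁ := by rw [hδ]; field_simp
  have hl : ∀ mn, latticePoint ω₁ ω₂ mn = 2 * ω₁ * normLattice δ mn := fun mn => by
    rw [latticePoint, normLattice, hω₂]
    ring
  have h1 : 2 * ω₁ * weierstrassZeta ω₁ ω₂ (2 * ω₁ * w) - 1 / w =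
      ∑' mn : {mn : ℤ × ℤ // mn ≠ 0}, (1 / (w - normLattice δ mn) +
      1 / normLattice δ mn + w / normLattice δ mn ^ 2) := by
    rw [weierstrassZeta, mul_add, ← tsum_mul_left, show 2 * ω₁ * (1 / (2 * ω₁ * w)) = 1 / w by
      field_simp, add_sub_cancel_left]
    refine tsum_congr fun mn => ?_
    have hn := normLattice_ne_zero hδ_pos mn.2
    rw [hl, ← mul_sub]
    generalize w - normLattice δ mn = v
    -- If `w` is itself a lattice point, the singular terms on both sides are `1 / 0 = 0`.
    rcases eq_or_ne v 0 with rfl | hv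
    · simp
      field_simp
    · field_simp
  rw [h1]
  exact (summable_zeta_terms hδ_pos w).hasSum

/-- The corrections `1 / l + w / l²` are affine in `w`, so the second difference removes them; the
origin then joins the other lattice points on an equal footing. -/
theorem hasSum_kernelT_lattice {ω₁ ω₂ δ γ : ℂ} (hδ : δ = ω₂ / ω₁) (hδ_pos : 0 < δ.im) (z : ℂ) :
    HasSum (fun mn : ℤ × ℤ => discreteLaplacian γ (fun w => 1 / (w - normLattice δ mn)) z)
      (2 * ω₁ * kernelT ω₁ ω₂ γ z) := by
  have h := ((hasSum_weierstrassZeta hδ hδ_pos (z - γ)).sub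
    ((hasSum_weierstrassZeta hδ hδ_pos z).mul_left 2)).add
    (hasSum_weierstrassZeta hδ hδ_pos (z + γ))
  have h0 : HasSum ((fun mn : ℤ × ℤ => discreteLaplacian γ (fun w => 1 / (w - normLattice δ mn)) z)
      ∘ ((↑) : ({0} : Set (ℤ × ℤ)) → ℤ × ℤ)) (discreteLaplacian γ (fun w => 1 / w) z) := by
    convert hasSum_unique (β := ({0} : Set (ℤ × ℤ))) _ using 1
    simp [normLattice]
  have h1 := (h0.hasSum_compl_iff (a₂ := 2 * ω₁ * kernelT ω₁ ω₂ γ z -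
    discreteLaplacian γ (fun w => 1 / w) z)).mp (by
      have h2 : (2 * ω₁ * weierstrassZeta ω₁ ω₂ (2 * ω₁ * (z - γ)) - 1 / (z - γ) -
          2 * (2 * ω₁ * weierstrassZeta ω₁ ω₂ (2 * ω₁ * z) - 1 / z) +
          (2 * ω₁ * weierstrassZeta ω₁ ω₂ (2 * ω₁ * (z + γ)) - 1 / (z + γ))) =
          2 * ω₁ * kernelT ω₁ ω₂ γ z - discreteLaplacian γ (fun w => 1 / w) z := by
        simp only [kernelT, discreteLaplacian]
        ring
      rw [h2] at h
      refine HasSum.congr_fun h fun mn => ?_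
      simp only [Function.comp_apply, discreteLaplacian]
      ring)
  rwa [add_sub_cancel] at h1

/-- The simple poles along a row are not absolutely summable, but their second differences are; the
three cotangent expansions are therefore combined pair by pair. -/
theorem hasSum_laplacian_cotPi {γ z : ℂ} (hz : ∀ n : ℤ, z ≠ n) (hz1 : ∀ n : ℤ, z - γ ≠ n)
    (hz2 : ∀ n : ℤ, z + γ ≠ n)
    (hs : Summable fun m : ℤ => discreteLaplacian γ (fun w => 1 / (w - m)) z) :
    HasSum (fun m : ℤ => discreteLaplacian γ (fun w => 1 / (w - m)) z)
      (discreteLaplacian γ cotPi z) := by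
  have h := ((hasSum_cotPi hz1).sub ((hasSum_cotPi hz).mul_left 2)).add (hasSum_cotPi hz2)
  have h1 := hasSum_int_of_pairs hs (h.congr_fun fun n => by
    simp only [discreteLaplacian]
    push_cast
    ring)
  convert h1 using 1
  simp only [discreteLaplacian]
  push_cast
  ring

theorem hasSum_kernelT {ω₁ ω₂ δ γ : ℂ} (hδ : δ = ω₂ / ω₁) (hγ : 0 < γ.im) (hγδ : γ.im < δ.im)
    {s : ℝ} (hs : ∀ n : ℤ, s ≠ n) :
    HasSum (fun n : ℕ => discreteLaplacian γ cotPi (s + (n + 1) * δ) -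
      discreteLaplacian γ cotPi ((-s : ℝ) + (n + 1) * δ))
      (2 * ω₁ * kernelT ω₁ ω₂ γ s - discreteLaplacian γ cotPi s) := by
  have hδ_pos := hγ.trans hγδ
  have h := hasSum_kernelT_lattice (γ := γ) hδ hδ_pos s
  have h1 := (Equiv.prodComm ℤ ℤ).hasSum_iff.mpr h
  have hshift : ∀ n m : ℤ, discreteLaplacian γ (fun w => 1 / (w - normLattice δ (m, n))) s =
      discreteLaplacian γ (fun w => 1 / (w - m)) (s - n * δ) := fun n m => by
    simp only [discreteLaplacian, normLattice]
    ring_nf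
  -- No pole is met: an integer value forces `n Im δ = c Im γ`, hence `n = 0` because `Im γ < Im δ`
  -- and `|c| ≤ 1`, then `c = 0`, and `s` is not an integer.
  have hnz : ∀ (n : ℤ) (c : ℤ), c.natAbs ≤ 1 → ∀ m : ℤ,
      (s - n * δ) + c * γ ≠ m := fun n c hc m hm => by
    have him := congrArg Complex.im hm
    simp at him
    have hc' : c = -1 ∨ c = 0 ∨ c = 1 := by omega
    have hn : n = 0 := by
      by_contra hn
      have h2 : (1 : ℝ) ≤ |(n : ℝ)| := by exact_mod_cast Int.one_le_abs hn
      have h3 : |(n : ℝ)| * δ.im = |(c : ℝ)| * γ.im := by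
        have h5 : (n : ℝ) * δ.im = c * γ.im := by linarith
        have h6 := congrArg abs h5
        rwa [abs_mul, abs_mul, abs_of_pos hδ_pos, abs_of_pos hγ] at h6
      have h4 : |(c : ℝ)| ≤ 1 := by
        rcases hc' with rfl | rfl | rfl <;> simp
      nlinarith [abs_nonneg (c : ℝ)]
    subst hn
    have hc0 : c = 0 := by
      rcases hc' with rfl | rfl | rfl
      · simp at him; linarith
      · rfl
      · simp at him; linarith
    subst hc0
    simp at hm
    exact hs m (by exact_mod_cast hm)
  have hfib : ∀ n : ℤ, HasSum (fun m : ℤ => discreteLaplacian γ (fun w => 1 / (w - m)) (s - n * δ))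
      (discreteLaplacian γ cotPi (s - n * δ)) := fun n => by
    refine hasSum_laplacian_cotPi (fun m => ?_) (fun m => ?_) (fun m => ?_) ?_
    · simpa using hnz n 0 (by simp) m
    · simpa [sub_eq_add_neg] using hnz n (-1) (by simp) m
    · simpa using hnz n 1 (by simp) m
    · exact (h1.summable.prod_factor n).congr fun m => hshift n m
  have h2 := h1.prod_fiberwise (g := fun n : ℤ => discreteLaplacian γ cotPi (s - n * δ))
    fun n => (hfib n).congr_fun fun m => hshift n m
  -- Pairing rows `n` and `-n` counts row `0` twice; removing the index `0` from the paired sum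
  -- leaves the total minus row `0` once.
  have h3 := h2.nat_add_neg
  have h4 := (hasSum_nat_add_iff' 1).mpr h3
  simp only [Finset.sum_range_one] at h4
  have h5 : 2 * ω₁ * kernelT ω₁ ω₂ γ s - discreteLaplacian γ cotPi s =
      2 * ω₁ * kernelT ω₁ ω₂ γ s + discreteLaplacian γ cotPi (s - (0 : ℤ) * δ) -
      (discreteLaplacian γ cotPi (s - ((0 : ℕ) : ℤ) * δ) +
        discreteLaplacian γ cotPi (s - ((-((0 : ℕ) : ℤ) : ℤ) : ℂ) * δ)) := by
    simp
  rw [h5]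
  refine h4.congr_fun fun n => ?_
  have h6 : discreteLaplacian γ cotPi ((-s : ℝ) + (n + 1) * δ) =
      -discreteLaplacian γ cotPi (s - (n + 1) * δ) := by
    rw [← laplacian_cotPi_neg]
    congr 1
    push_cast
    ring
  rw [h6]
  push_cast
  ring_nf

theorem norm_exp_two_pi_I_mul (z : ℂ) :
    ‖Complex.exp (2 * Real.pi * Complex.I * z)‖ = Real.exp (-(2 * Real.pi * z.im)) := by
  simp [Complex.norm_exp]

theorem norm_exp_two_pi_I_mul_lt {z w : ℂ} (h : w.im < z.im) :
    ‖Complex.exp (2 * Real.pi * Complex.I * z)‖ < ‖Complex.exp (2 * Real.pi * Complex.I * w)‖ := by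
  rw [norm_exp_two_pi_I_mul, norm_exp_two_pi_I_mul, Real.exp_lt_exp]
  nlinarith [Real.pi_pos]

theorem norm_exp_two_pi_I_mul_lt_one {z : ℂ} (h : 0 < z.im) :
    ‖Complex.exp (2 * Real.pi * Complex.I * z)‖ < 1 := by
  simpa using norm_exp_two_pi_I_mul_lt (w := 0) (z := z) (by simpa using h)

theorem one_sub_exp_zpow_ne_zero {δ : ℂ} (hδ : 0 < δ.im) {n : ℤ} (hn : n ≠ 0) :
    1 - Complex.exp (2 * Real.pi * Complex.I * δ) ^ n ≠ 0 := fun h => by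
  have h1 : ‖Complex.exp (2 * Real.pi * Complex.I * δ) ^ n‖ = 1 := by
    rw [← sub_eq_zero.mp h, norm_one]
  rw [← Complex.exp_int_mul, Complex.norm_exp, Real.exp_eq_one_iff] at h1
  simp [hn, Real.pi_ne_zero, hδ.ne'] at h1

theorem structureConst_neg {δ γ : ℂ} (hδ : 0 < δ.im) (n : ℤ) :
    structureConst δ γ (-n) = -structureConst δ γ n := by
  rcases eq_or_ne n 0 with rfl | hn
  · simp [structureConst]
  have hp := one_sub_exp_zpow_ne_zero hδ hn
  have hp' := one_sub_exp_zpow_ne_zero hδ (neg_ne_zero.mpr hn)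
  unfold structureConst
  rw [← neg_div, div_eq_div_iff hp' hp]
  have hP := zpow_ne_zero n (Complex.exp_ne_zero (2 * Real.pi * Complex.I * δ))
  have hQ := zpow_ne_zero n (Complex.exp_ne_zero (2 * Real.pi * Complex.I * γ))
  simp only [neg_neg, zpow_neg]
  field_simp
  ring

@[simp] theorem structureConst_zero (δ γ : ℂ) : structureConst δ γ 0 = 0 := by
  simp [structureConst]

theorem hasSum_laplacian_cotPi_exp {γ z : ℂ} (hz : 0 < z.im) (hz1 : 0 < (z - γ).im)
    (hz2 : 0 < (z + γ).im) :
    HasSum (fun k : ℕ => -(2 * Real.pi * Complex.I) *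
      discreteLaplacian γ (fun w => Complex.exp (2 * Real.pi * Complex.I * w) ^ (k + 1)) z)
      (discreteLaplacian γ cotPi z) := by
  have h := ((hasSum_cotPi_geometric hz1).sub ((hasSum_cotPi_geometric hz).mul_left 2)).add
    (hasSum_cotPi_geometric hz2)
  rw [show discreteLaplacian γ cotPi z = (cotPi (z - γ) + Real.pi * Complex.I -
      2 * (cotPi z + Real.pi * Complex.I)) + (cotPi (z + γ) + Real.pi * Complex.I) by
    rw [discreteLaplacian]; ring]
  refine h.congr_fun fun k => ?_
  rw [discreteLaplacian]
  ring

/-- Justifies exchanging rows and frequencies. The worst factor is `q^(-k)`, and `|p| < |q|` makes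
the sums over `n` decay like `(|p| / |q|)^k`. -/
theorem summable_lattice_exp {p q : ℂ} (hq0 : q ≠ 0) (hq : ‖q‖ < 1) (hpq : ‖p‖ < ‖q‖) :
    Summable fun kn : ℕ × ℕ => ((q ^ (kn.1 + 1))⁻¹ - 2 + q ^ (kn.1 + 1)) *
      (p ^ (kn.1 + 1)) ^ (kn.2 + 1) := by
  have hp : ‖p‖ < 1 := hpq.trans hq
  have hq0' : 0 < ‖q‖ := norm_pos_iff.mpr hq0
  have hpk : ∀ k : ℕ, ‖p‖ ^ (k + 1) ≤ ‖p‖ := fun k =>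
    pow_le_of_le_one (norm_nonneg _) hp.le k.succ_ne_zero
  have hgeo : ∀ k : ℕ, HasSum (fun n : ℕ => (‖p‖ ^ (k + 1)) ^ (n + 1))
      ((1 - ‖p‖ ^ (k + 1))⁻¹ * ‖p‖ ^ (k + 1)) := fun k => by
    refine ((hasSum_geometric_of_lt_one (by positivity) ((hpk k).trans_lt hp)).mul_right
      (‖p‖ ^ (k + 1))).congr_fun fun n => ?_
    rw [pow_succ (‖p‖ ^ (k + 1)) n]
  have hmaj : Summable fun kn : ℕ × ℕ => 4 * (‖q‖ ^ (kn.1 + 1))⁻¹ *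
      (‖p‖ ^ (kn.1 + 1)) ^ (kn.2 + 1) := by
    have hnn : 0 ≤ fun kn : ℕ × ℕ => 4 * (‖q‖ ^ (kn.1 + 1))⁻¹ * (‖p‖ ^ (kn.1 + 1)) ^ (kn.2 + 1) :=
      fun kn => by positivity
    have hrow : ∀ k : ℕ, HasSum (fun n : ℕ => 4 * (‖q‖ ^ (k + 1))⁻¹ * (‖p‖ ^ (k + 1)) ^ (n + 1))
        (4 * (‖q‖ ^ (k + 1))⁻¹ * ((1 - ‖p‖ ^ (k + 1))⁻¹ * ‖p‖ ^ (k + 1))) := fun k =>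
      (hgeo k).mul_left (4 * (‖q‖ ^ (k + 1))⁻¹)
    refine (summable_prod_of_nonneg hnn).mpr ⟨fun k => (hrow k).summable, ?_⟩
    rw [show (fun k : ℕ => ∑' n : ℕ, 4 * (‖q‖ ^ (k + 1))⁻¹ * (‖p‖ ^ (k + 1)) ^ (n + 1)) = _ from
      funext fun k => (hrow k).tsum_eq]
    have hr : ‖p‖ / ‖q‖ < 1 := (div_lt_one hq0').mpr hpq
    refine Summable.of_nonneg_of_le (fun k => ?_) (fun k => ?_)
      (((summable_nat_add_iff 1).mpr (summable_geometric_of_lt_one (by positivity) hr)).mul_left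
        (4 * (1 - ‖p‖)⁻¹))
    · have : 0 ≤ (1 - ‖p‖ ^ (k + 1))⁻¹ := inv_nonneg.mpr (by linarith [hpk k])
      positivity
    · have h1 : (1 - ‖p‖ ^ (k + 1))⁻¹ ≤ (1 - ‖p‖)⁻¹ :=
        inv_anti₀ (by linarith) (by linarith [hpk k])
      calc 4 * (‖q‖ ^ (k + 1))⁻¹ * ((1 - ‖p‖ ^ (k + 1))⁻¹ * ‖p‖ ^ (k + 1))
          ≤ 4 * (‖q‖ ^ (k + 1))⁻¹ * ((1 - ‖p‖)⁻¹ * ‖p‖ ^ (k + 1)) := by gcongr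
        _ = 4 * (1 - ‖p‖)⁻¹ * (‖p‖ / ‖q‖) ^ (k + 1) := by
          rw [div_pow]
          ring
  refine Summable.of_norm_bounded hmaj fun kn => ?_
  have hqk : ‖q‖ ^ (kn.1 + 1) ≤ 1 := pow_le_one₀ (norm_nonneg _) hq.le
  have hqk1 : 1 ≤ (‖q‖ ^ (kn.1 + 1))⁻¹ := (one_le_inv₀ (by positivity)).mpr hqk
  rw [norm_mul, norm_pow, norm_pow]
  gcongr
  calc ‖(q ^ (kn.1 + 1))⁻¹ - 2 + q ^ (kn.1 + 1)‖
      ≤ ‖(q ^ (kn.1 + 1))⁻¹‖ + ‖(2 : ℂ)‖ + ‖q ^ (kn.1 + 1)‖ :=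
        (norm_add_le _ _).trans (by gcongr; exact norm_sub_le _ _)
    _ ≤ 4 * (‖q‖ ^ (kn.1 + 1))⁻¹ := by
        rw [norm_inv, norm_pow, Complex.norm_ofNat]
        linarith

/-- Half of the Fourier expansion of the kernel. -/
theorem hasSum_half_kernel {δ γ : ℂ} (hγ : 0 < γ.im) (hγδ : γ.im < δ.im) (s : ℝ) :
    ∃ b : ℂ, HasSum (fun n : ℕ => discreteLaplacian γ cotPi (s + (n + 1) * δ)) b ∧
      HasSum (fun k : ℕ => -(2 * Real.pi * Complex.I) * (1 - structureConst δ γ (k + 1)) *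
        mode (k + 1) s) (b + (cotPi (s + γ) + Real.pi * Complex.I)) := by
  set p := Complex.exp (2 * Real.pi * Complex.I * δ) with hp
  set q := Complex.exp (2 * Real.pi * Complex.I * γ) with hq
  have hδ := hγ.trans hγδ
  have hq0 : q ≠ 0 := Complex.exp_ne_zero _
  have hp0 : p ≠ 0 := Complex.exp_ne_zero _
  have hp1 : ‖p‖ < 1 := norm_exp_two_pi_I_mul_lt_one hδ
  have hS := ((summable_lattice_exp hq0 (norm_exp_two_pi_I_mul_lt_one hγ)
    (norm_exp_two_pi_I_mul_lt hγδ)).norm)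
  set F : ℕ × ℕ → ℂ := fun kn => -(2 * Real.pi * Complex.I) *
    (((q ^ (kn.1 + 1))⁻¹ - 2 + q ^ (kn.1 + 1)) * (p ^ (kn.1 + 1)) ^ (kn.2 + 1)) *
      mode (kn.1 + 1) s with hF
  have hFs : Summable F := by
    refine Summable.of_norm ((hS.mul_left ‖-(2 * Real.pi * Complex.I : ℂ)‖).congr fun kn => ?_)
    rw [hF, norm_mul _ (mode _ _), norm_mode, mul_one, norm_mul (-(2 * Real.pi * Complex.I : ℂ))]
  have hmode : ∀ (k : ℕ) (z : ℂ), Complex.exp (2 * Real.pi * Complex.I * (s + z)) ^ (k + 1) =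
      mode (k + 1) s * Complex.exp (2 * Real.pi * Complex.I * z) ^ (k + 1) := fun k z => by
    rw [mode, ← Complex.exp_nat_mul, ← Complex.exp_nat_mul, ← Complex.exp_add]
    congr 1
    push_cast
    ring
  have hexp : ∀ (k n : ℕ) , Complex.exp (2 * Real.pi * Complex.I * ((n + 1) * δ)) ^ (k + 1) =
      (p ^ (k + 1)) ^ (n + 1) := fun k n => by
    rw [hp, ← pow_mul, ← Complex.exp_nat_mul, ← Complex.exp_nat_mul]
    congr 1
    push_cast
    ring
  have h1 : ∀ n : ℕ, HasSum (fun k : ℕ => F (k, n))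
      (discreteLaplacian γ cotPi (s + (n + 1) * δ)) := fun n => by
    -- Keeps the points `s + (n+1)δ` and their shifts by `±γ` in the upper half plane, where all
    -- three geometric expansions hold.
    have him : γ.im < (n + 1) * δ.im := by nlinarith [Nat.cast_nonneg (α := ℝ) n]
    refine (hasSum_laplacian_cotPi_exp (γ := γ) (z := s + (n + 1) * δ) (by simp; linarith)
      (by simp; linarith) (by simp; linarith)).congr_fun fun k => ?_
    simp only [hF, discreteLaplacian]
    rw [show (s + (n + 1) * δ - γ : ℂ) = s + ((n + 1) * δ + -γ) by ring,
      show (s + (n + 1) * δ + γ : ℂ) = s + ((n + 1) * δ + γ) by ring, hmode, hmode, hmode,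
      mul_add _ _ γ, mul_add _ _ (-γ), Complex.exp_add, Complex.exp_add, mul_neg, Complex.exp_neg,
      mul_pow, mul_pow, hexp, ← hq, inv_pow]
    ring
  have h2 : ∀ k : ℕ, HasSum (fun n : ℕ => F (k, n)) (-(2 * Real.pi * Complex.I) *
      (((q ^ (k + 1))⁻¹ - 2 + q ^ (k + 1)) * ((1 - p ^ (k + 1))⁻¹ * p ^ (k + 1))) *
      mode (k + 1) s) := fun k => by
    have hpk : ‖p ^ (k + 1)‖ < 1 := by
      rw [norm_pow]
      exact pow_lt_one₀ (norm_nonneg _) hp1 k.succ_ne_zero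
    have h3 := (((hasSum_geometric_of_norm_lt_one hpk).mul_right (p ^ (k + 1))).mul_left
      ((q ^ (k + 1))⁻¹ - 2 + q ^ (k + 1))).mul_left (-(2 * Real.pi * Complex.I))
    refine (h3.mul_right (mode (k + 1) s)).congr_fun fun n => ?_
    simp only [hF]
    rw [pow_succ (p ^ (k + 1)) n]
  have h3 := hFs.hasSum
  have h4 := ((Equiv.prodComm ℕ ℕ).hasSum_iff.mpr h3).prod_fiberwise h1
  have h5 := h3.prod_fiberwise h2
  refine ⟨_, h4, ?_⟩
  -- The part `cot(π(s + γ))` of row `0` contributes `q^k`, and `(q^(-k) - 2 + q^k) p^k / (1 - p^k)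
  -- + q^k = 1 - c_k`.
  have h6 := hasSum_cotPi_geometric (z := s + γ) (by simpa using hγ)
  refine (h5.add h6).congr_fun fun k => ?_
  have hpk : 1 - p ^ (k + 1) ≠ 0 := by
    have := one_sub_exp_zpow_ne_zero hδ (n := k + 1) (by omega)
    rw [← hp] at this
    exact_mod_cast this
  have hQ := pow_ne_zero (k + 1) hq0
  rw [hmode, ← hq, structureConst, ← hp, ← hq, zpow_neg]
  norm_cast
  field_simp
  ring

/-- On the real line the kernel is a multiple of `cot` plus an absolutely convergent Fourier
series. -/
theorem exists_kernelT_eq {ω₁ ω₂ δ γ : ℂ} (hδ : δ = ω₂ / ω₁) (hγ : 0 < γ.im)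
    (hγδ : γ.im < δ.im) : ∃ R : ℝ → ℂ,
      HasFourier R (fun k => (k.sign : ℂ) - structureConst δ γ k) ∧
      ∀ s : ℝ, (∀ n : ℤ, s ≠ n) → Complex.I * ω₁ / Real.pi * kernelT ω₁ ω₂ γ s =
        -Complex.I * Complex.cot (Real.pi * s) + R s := by
  have hδ_pos := hγ.trans hγδ
  choose b hb hbs using hasSum_half_kernel hγ hγδ
  have hpi : (Real.pi : ℂ) ≠ 0 := by exact_mod_cast Real.pi_ne_zero
  -- The factor `i / (2π)` is the inverse of `-2πi`. In `B s - B (-s)` the two constants `πi`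
  -- cancel, and oddness of `c` supplies the negative frequencies.
  set B : ℝ → ℂ := fun s => (b s + (cotPi (s + γ) + Real.pi * Complex.I)) *
    (Complex.I / (2 * Real.pi)) with hB
  have hBs : ∀ s, HasSum (fun k : ℕ => (1 - structureConst δ γ (k + 1)) * mode (k + 1) s) (B s) :=
    fun s => by
      refine ((hbs s).mul_right (Complex.I / (2 * Real.pi))).congr_fun fun k => ?_
      field_simp
      rw [Complex.I_sq]
      ring
  have hsum : Summable fun k : ℕ => 1 - structureConst δ γ (k + 1) := by
    simpa using (hBs 0).summable
  have hsign : ∀ n : ℕ, Int.sign ((n : ℤ) + 1) = 1 := fun n => Int.sign_eq_one_of_pos (by omega)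
  refine ⟨fun s => B s - B (-s), ⟨?_, fun s => ?_⟩, fun s hs => ?_⟩
  · refine Summable.of_add_one_of_neg_add_one (by simpa [hsign] using hsum) ?_
    simp only [Int.sign_neg, structureConst_neg hδ_pos, hsign]
    refine hsum.neg.congr fun k => ?_
    push_cast
    ring
  · have h1 := HasSum.of_add_one_of_neg_add_one
      (f := fun k : ℤ => ((k.sign : ℂ) - structureConst δ γ k) * mode k s) (m := B s)
      (m' := -B (-s)) (by simpa [hsign] using hBs s) (by
        refine (hBs (-s)).neg.congr_fun fun k => ?_
        rw [mode_neg, Int.sign_neg, structureConst_neg hδ_pos, hsign]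
        push_cast
        ring)
    simpa [sub_eq_add_neg] using h1
  · have h1 := (hasSum_kernelT hδ hγ hγδ hs).unique ((hb s).sub (hb (-s)))
    have h2 : discreteLaplacian γ cotPi s = cotPi (s + γ) - cotPi ((-s : ℝ) + γ) -
        2 * cotPi s := by
      rw [discreteLaplacian, show (s : ℂ) - γ = -((-s : ℝ) + γ) by push_cast; ring, cotPi_neg]
      ring
    rw [h2] at h1
    have h3 : 2 * ω₁ * kernelT ω₁ ω₂ γ s = b s - b (-s) + (cotPi (s + γ) - cotPi ((-s : ℝ) + γ) -
        2 * cotPi s) := by linear_combination h1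
    have h4 : Complex.I * ω₁ / Real.pi * kernelT ω₁ ω₂ γ s =
        Complex.I / (2 * Real.pi) * (2 * ω₁ * kernelT ω₁ ω₂ γ s) := by
      field_simp
    rw [h4, h3, hB, cotPi.eq_1 s]
    field_simp
    ring

/-! ### The conjugate function of a character -/

/-- `∫_r^{1/2} cot(πs) sin(2πks) ds`. -/
def cotSinIntegral (k : ℤ) (r : ℝ) : ℝ :=
  ∫ s in r..(1 / 2), Real.cot (Real.pi * s) * Real.sin (2 * Real.pi * k * s)

theorem sin_pi_mul_pos {s : ℝ} (h0 : 0 < s) (h1 : s < 1) : 0 < Real.sin (Real.pi * s) :=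
  Real.sin_pos_of_pos_of_lt_pi (by have := Real.pi_pos; positivity)
    (by nlinarith [Real.pi_pos])

theorem continuousOn_cot_pi_mul : ContinuousOn (fun s => Real.cot (Real.pi * s)) (Set.Ioo 0 1) := by
  simp only [Real.cot_eq_cos_div_sin]
  exact ContinuousOn.div (by fun_prop) (by fun_prop) fun s hs => (sin_pi_mul_pos hs.1 hs.2).ne'

theorem intervalIntegrable_cot_mul {r b : ℝ} (hr : 0 < r) (hb0 : 0 < b) (hb : b < 1) (hr1 : r < 1)
    {g : ℝ → ℝ} (hg : Continuous g) :
    IntervalIntegrable (fun s => Real.cot (Real.pi * s) * g s) MeasureTheory.volume r b := by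
  refine ContinuousOn.intervalIntegrable ((continuousOn_cot_pi_mul.mono fun s hs => ?_).mul
    hg.continuousOn)
  rw [Set.mem_uIcc] at hs
  constructor <;> rcases hs with hs | hs <;> linarith

/-- With `u = πs`, the identity `cot u (sin (2(k+1)u) - sin (2ku)) = cos (2(k+1)u) + cos (2ku)`
removes the singularity and makes the integrals telescope. -/
theorem cotSinIntegral_succ_sub (k : ℤ) {r : ℝ} (hr : 0 < r) (hr1 : r < 1 / 2) :
    cotSinIntegral (k + 1) r - cotSinIntegral k r =
      ∫ s in r..(1 / 2), (Real.cos (2 * Real.pi * (k + 1 : ℤ) * s) +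
        Real.cos (2 * Real.pi * k * s)) := by
  rw [cotSinIntegral, cotSinIntegral, ← intervalIntegral.integral_sub
    (intervalIntegrable_cot_mul hr (by norm_num) (by norm_num) (by linarith) (by fun_prop))
    (intervalIntegrable_cot_mul hr (by norm_num) (by norm_num) (by linarith) (by fun_prop))]
  refine intervalIntegral.integral_congr fun s hs => ?_
  rw [Set.uIcc_of_le hr1.le] at hs
  have hsin := (sin_pi_mul_pos (hr.trans_le hs.1) (by linarith [hs.2])).ne'
  simp only [Real.cot_eq_cos_div_sin]
  rw [show 2 * Real.pi * ((k + 1 : ℤ) : ℝ) * s = 2 * Real.pi * k * s + 2 * (Real.pi * s) by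
    push_cast; ring, Real.sin_add, Real.cos_add, Real.sin_two_mul, Real.cos_two_mul]
  have := Real.sin_sq_add_cos_sq (Real.pi * s)
  generalize Real.pi * s = u at *
  generalize 2 * Real.pi * (k : ℝ) * s = v
  field_simp
  linear_combination (2 * Real.sin v * Real.cos u) * this

theorem integral_cos_half (k : ℤ) :
    ∫ s in (0 : ℝ)..(1 / 2), Real.cos (2 * Real.pi * k * s) = if k = 0 then 1 / 2 else 0 := by
  split_ifs with hk
  · subst hk
    simp
  · have hc : (2 * Real.pi * k : ℝ) ≠ 0 := by
      simp [hk, Real.pi_ne_zero]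
    rw [intervalIntegral.integral_comp_mul_left (fun s => Real.cos s) hc, integral_cos,
      show 2 * Real.pi * (k : ℝ) * (1 / 2) = k * Real.pi by ring, Real.sin_int_mul_pi]
    simp

theorem tendsto_integral_left {E : Type*} [NormedAddCommGroup E] [NormedSpace ℝ E]
    {g : ℝ → E} (hg : Continuous g) (b : ℝ) :
    Filter.Tendsto (fun r => ∫ s in r..b, g s) (𝓝[>] 0) (𝓝 (∫ s in (0 : ℝ)..b, g s)) := by
  have h : Continuous fun r => ∫ s in r..b, g s := by
    simp only [intervalIntegral.integral_symm b]
    exact (intervalIntegral.continuous_primitive (fun _ _ => hg.intervalIntegrable _ _) b).neg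
  exact (h.tendsto 0).mono_left nhdsWithin_le_nhds

theorem cotSinIntegral_neg (k : ℤ) (r : ℝ) : cotSinIntegral (-k) r = -cotSinIntegral k r := by
  simp [cotSinIntegral]

theorem eventually_Ioo_half : ∀ᶠ r : ℝ in 𝓝[>] 0, r ∈ Set.Ioo 0 (1 / 2) :=
  Ioo_mem_nhdsGT (by norm_num)

/-- By telescoping in `k`: the only nonzero increment in the limit is `∫ 1 = 1/2`, at the step from
`0` to `1`. -/
theorem tendsto_cotSinIntegral (k : ℤ) :
    Filter.Tendsto (cotSinIntegral k) (𝓝[>] 0) (𝓝 ((k.sign : ℝ) / 2)) := by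
  have hnat : ∀ n : ℕ, Filter.Tendsto (cotSinIntegral n) (𝓝[>] 0)
      (𝓝 (((n : ℤ).sign : ℝ) / 2)) := fun n => by
    induction n with
    | zero =>
      rw [show cotSinIntegral ((0 : ℕ) : ℤ) = fun _ => 0 by ext; simp [cotSinIntegral]]
      simp
    | succ n ih =>
      have h1 := tendsto_integral_left (g := fun s => Real.cos (2 * Real.pi * (n + 1 : ℤ) * s) +
        Real.cos (2 * Real.pi * (n : ℤ) * s)) (by fun_prop) (1 / 2)
      rw [intervalIntegral.integral_add (by apply Continuous.intervalIntegrable; fun_prop)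
        (by apply Continuous.intervalIntegrable; fun_prop), integral_cos_half,
        integral_cos_half, if_neg (by omega)] at h1
      have h2 := ih.add h1
      have hlim : ((n : ℤ).sign : ℝ) / 2 + (0 + if (n : ℤ) = 0 then 1 / 2 else 0) =
          (((n + 1 : ℕ) : ℤ).sign : ℝ) / 2 := by
        rw [Int.sign_eq_one_of_pos (a := ((n + 1 : ℕ) : ℤ)) (by omega)]
        rcases Nat.eq_zero_or_pos n with rfl | hn
        · simp
        · rw [Int.sign_eq_one_of_pos (by omega), if_neg (by omega)]
          simp
      rw [hlim] at h2
      refine h2.congr' ?_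
      filter_upwards [eventually_Ioo_half] with r hr
      rw [← cotSinIntegral_succ_sub _ hr.1 hr.2]
      push_cast
      ring
  rcases Int.eq_nat_or_neg k with ⟨n, rfl | rfl⟩
  · exact hnat n
  · rw [show cotSinIntegral (-(n : ℤ)) = fun r => -cotSinIntegral n r from
      funext (cotSinIntegral_neg n), Int.sign_neg]
    convert (hnat n).neg using 2
    push_cast
    ring

theorem cot_pi_mul_le {s : ℝ} (h0 : 0 < s) (h1 : s ≤ 1 / 2) :
    0 ≤ Real.cot (Real.pi * s) ∧ Real.cot (Real.pi * s) ≤ 1 / (Real.pi * s) := by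
  have hπ := Real.pi_pos
  have hsin := sin_pi_mul_pos h0 (by linarith)
  have hps : 0 < Real.pi * s := by positivity
  have hps2 : Real.pi * s ≤ Real.pi / 2 := by nlinarith
  have hcos : 0 ≤ Real.cos (Real.pi * s) :=
    Real.cos_nonneg_of_neg_pi_div_two_le_of_le (by linarith) hps2
  rw [Real.cot_eq_cos_div_sin]
  refine ⟨by positivity, ?_⟩
  rw [div_le_div_iff₀ hsin hps, one_mul]
  rcases hps2.lt_or_eq with h | h
  · have h2 := Real.lt_tan hps h
    have hcos' : 0 < Real.cos (Real.pi * s) :=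
      Real.cos_pos_of_mem_Ioo ⟨by linarith, h⟩
    rw [Real.tan_eq_sin_div_cos, lt_div_iff₀ hcos'] at h2
    linarith
  · rw [h, Real.cos_pi_div_two]
    simp

theorem hasDerivAt_cot_pi_mul {s : ℝ} (h0 : 0 < s) (h1 : s < 1) :
    HasDerivAt (fun s => Real.cot (Real.pi * s)) (-(Real.pi / Real.sin (Real.pi * s) ^ 2)) s := by
  have hsin := (sin_pi_mul_pos h0 h1).ne'
  have hm : HasDerivAt (fun s => Real.pi * s) Real.pi s := by
    simpa using (hasDerivAt_id s).const_mul Real.pi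
  simp only [Real.cot_eq_cos_div_sin]
  refine (hm.cos.div hm.sin hsin).congr_deriv ?_
  have := Real.sin_sq_add_cos_sq (Real.pi * s)
  field_simp
  linear_combination -this

/-- Integration by parts with the primitive `d - c cos` of the sine. Since `cot` decreases, the
choices `d = c` and `d = -c` give the remaining term a fixed sign, so it can be dropped for a lower
and an upper bound respectively. -/
theorem abs_integral_cot_mul_sin_le {k : ℕ} (hk : 0 < k) {a : ℝ} (ha : 0 < a) (ha1 : a ≤ 1 / 2) :
    |∫ s in a..(1 / 2), Real.cot (Real.pi * s) * Real.sin (2 * Real.pi * k * s)| ≤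
      Real.cot (Real.pi * a) / (Real.pi * k) := by
  have hπ := Real.pi_pos
  have hk0 : (0 : ℝ) < k := by exact_mod_cast hk
  set c : ℝ := 1 / (2 * Real.pi * k) with hc
  have hc0 : 0 < c := by positivity
  have hcot := cot_pi_mul_le ha ha1
  have hhalf : Real.cot (Real.pi * (1 / 2)) = 0 := by
    rw [Real.cot_eq_cos_div_sin, show Real.pi * (1 / 2) = Real.pi / 2 by ring, Real.cos_pi_div_two]
    simp
  have hderiv : ∀ d : ℝ, ∀ s, 0 < s → s < 1 → HasDerivAt
      (fun s => Real.cot (Real.pi * s) * (d - c * Real.cos (2 * Real.pi * k * s)))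
      (-(Real.pi / Real.sin (Real.pi * s) ^ 2) * (d - c * Real.cos (2 * Real.pi * k * s)) +
        Real.cot (Real.pi * s) * Real.sin (2 * Real.pi * k * s)) s := fun d s h0 h1 => by
    have hm : HasDerivAt (fun s => 2 * Real.pi * k * s) (2 * Real.pi * k) s := by
      simpa using (hasDerivAt_id s).const_mul (2 * Real.pi * k)
    refine ((hasDerivAt_cot_pi_mul h0 h1).mul ((hm.cos.const_mul c).const_sub d)).congr_deriv ?_
    rw [hc]
    field_simp
  have hint : MeasureTheory.IntegrableOn
      (fun s => Real.cot (Real.pi * s) * Real.sin (2 * Real.pi * k * s)) (Set.Icc a (1 / 2)) := by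
    refine ContinuousOn.integrableOn_Icc ((continuousOn_cot_pi_mul.mono fun s hs => ?_).mul
      (by fun_prop))
    exact ⟨ha.trans_le hs.1, by linarith [hs.2]⟩
  have hcontOn : ∀ d : ℝ, ContinuousOn
      (fun s => Real.cot (Real.pi * s) * (d - c * Real.cos (2 * Real.pi * k * s)))
      (Set.Icc a (1 / 2)) := fun d s hs =>
    (hderiv d s (ha.trans_le hs.1) (by linarith [hs.2])).continuousAt.continuousWithinAt
  have hu : ∀ s : ℝ, 0 ≤ Real.pi / Real.sin (Real.pi * s) ^ 2 := fun s => by positivity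
  have hlow := intervalIntegral.sub_le_integral_of_hasDeriv_right_of_le ha1 (hcontOn c)
    (fun s hs => (hderiv c s (ha.trans hs.1) (by linarith [hs.2])).hasDerivWithinAt) hint
    fun s hs => by
      have : 0 ≤ c - c * Real.cos (2 * Real.pi * k * s) := by
        nlinarith [Real.cos_le_one (2 * Real.pi * k * s)]
      nlinarith [mul_nonneg (hu s) this]
  have hup := intervalIntegral.integral_le_sub_of_hasDeriv_right_of_le ha1 (hcontOn (-c))
    (fun s hs => (hderiv (-c) s (ha.trans hs.1) (by linarith [hs.2])).hasDerivWithinAt) hint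
    fun s hs => by
      have : 0 ≤ c + c * Real.cos (2 * Real.pi * k * s) := by
        nlinarith [Real.neg_one_le_cos (2 * Real.pi * k * s)]
      nlinarith [mul_nonneg (hu s) this]
  simp only [hhalf, zero_mul, zero_sub] at hlow hup
  have hval : Real.cot (Real.pi * a) / (Real.pi * k) = Real.cot (Real.pi * a) * (2 * c) := by
    rw [hc]
    field_simp
  rw [abs_le, hval]
  constructor
  · refine le_trans ?_ hlow
    rw [neg_le_neg_iff]
    refine mul_le_mul_of_nonneg_left ?_ hcot.1
    nlinarith [Real.neg_one_le_cos (2 * Real.pi * k * a)]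
  · refine hup.trans ?_
    rw [← mul_neg]
    refine mul_le_mul_of_nonneg_left ?_ hcot.1
    nlinarith [Real.cos_le_one (2 * Real.pi * k * a)]

/-- Uniformity in both `k` and `r` is what allows `r → 0` under the Fourier sum. Split at `1 /
(2n)`: below it the integrand is at most `2n`, from `cot u ≤ 1 / u` and `|sin v| ≤ v`; above it the
oscillation bound applies. Each part is at most `1`. -/
theorem abs_cotSinIntegral_le (k : ℤ) {r : ℝ} (hr : 0 < r) (hr1 : r < 1 / 2) :
    |cotSinIntegral k r| ≤ 2 := by
  have hπ := Real.pi_gt_three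
  suffices hnat : ∀ n : ℕ, 0 < n → |cotSinIntegral n r| ≤ 2 by
    rcases Int.eq_nat_or_neg k with ⟨n, rfl | rfl⟩
    all_goals rcases Nat.eq_zero_or_pos n with rfl | hn
    · simp [cotSinIntegral]
    · exact hnat n hn
    · simp [cotSinIntegral]
    · rw [cotSinIntegral_neg, abs_neg]
      exact hnat n hn
  intro n hn
  have hn0 : (1 : ℝ) ≤ n := by exact_mod_cast hn
  have htail : ∀ a : ℝ, 1 / (2 * n) ≤ a → a ≤ 1 / 2 → |∫ s in a..(1 / 2),
      Real.cot (Real.pi * s) * Real.sin (2 * Real.pi * n * s)| ≤ 1 := fun a ha ha1 => by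
    have ha0 : 0 < a := lt_of_lt_of_le (by positivity) ha
    refine (abs_integral_cot_mul_sin_le hn ha0 ha1).trans ?_
    rw [div_le_one (by positivity)]
    refine (cot_pi_mul_le ha0 ha1).2.trans ?_
    rw [div_le_iff₀ (by positivity)]
    rw [div_le_iff₀ (by positivity)] at ha
    have h9 : 9 ≤ Real.pi * Real.pi := by nlinarith
    have := mul_le_mul h9 (by linarith : 1 / 2 ≤ n * a) (by norm_num) (by positivity)
    linarith
  simp only [cotSinIntegral, Int.cast_natCast]
  rcases le_or_gt (1 / (2 * n) : ℝ) r with h | h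
  · exact (htail r h hr1.le).trans (by norm_num)
  · set a : ℝ := 1 / (2 * n) with ha
    have ha0 : 0 < a := by positivity
    have ha1 : a ≤ 1 / 2 := by
      rw [ha]
      apply one_div_le_one_div_of_le <;> linarith
    rw [← intervalIntegral.integral_add_adjacent_intervals (b := a)
      (intervalIntegrable_cot_mul hr ha0 (by linarith) (by linarith) (by fun_prop))
      (intervalIntegrable_cot_mul ha0 (by norm_num) (by norm_num) (by linarith) (by fun_prop))]
    have h1 : ‖∫ s in r..a, Real.cot (Real.pi * s) * Real.sin (2 * Real.pi * n * s)‖ ≤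
        2 * n * |a - r| := by
      refine intervalIntegral.norm_integral_le_of_norm_le_const fun s hs => ?_
      rw [Set.uIoc_of_le h.le] at hs
      have hs0 : 0 < s := hr.trans hs.1
      have hc := cot_pi_mul_le hs0 (hs.2.trans ha1)
      rw [norm_mul, Real.norm_eq_abs, Real.norm_eq_abs, abs_of_nonneg hc.1]
      have hsin : |Real.sin (2 * Real.pi * n * s)| ≤ 2 * Real.pi * n * s := by
        have := Real.abs_sin_le_abs (x := 2 * Real.pi * n * s)
        rwa [abs_of_nonneg (a := 2 * Real.pi * n * s) (by positivity)] at this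
      calc _ ≤ 1 / (Real.pi * s) * (2 * Real.pi * n * s) :=
            mul_le_mul hc.2 hsin (abs_nonneg _) (by positivity)
        _ = 2 * n := by field_simp
    rw [Real.norm_eq_abs, abs_of_pos (sub_pos.mpr h)] at h1
    have h2 : 2 * n * (a - r) ≤ 1 := by
      have : 2 * n * a = 1 := by rw [ha]; field_simp
      nlinarith
    refine (abs_add_le _ _).trans ?_
    linarith [htail a le_rfl ha1]

/-! ### The singular integral operator on absolutely convergent Fourier series -/

/-- A principal-value kernel: a multiple of `cot` plus a regular part. -/
def pvKernel (R : ℝ → ℂ) (s : ℝ) : ℂ := -Complex.I * Real.cot (Real.pi * s) + R s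

theorem continuousOn_pvKernel {R : ℝ → ℂ} (hR : Continuous R) :
    ContinuousOn (pvKernel R) (Set.Ioo 0 1) :=
  (continuousOn_const.mul (Complex.continuous_ofReal.comp_continuousOn
    continuousOn_cot_pi_mul)).add hR.continuousOn

theorem continuousOn_pvKernel_neg {R : ℝ → ℂ} (hR : Continuous R) :
    ContinuousOn (fun s => pvKernel R (-s)) (Set.Ioo 0 1) := by
  have h : ∀ s, pvKernel R (-s) = Complex.I * Real.cot (Real.pi * s) + R (-s) := fun s => by
    simp [pvKernel, Real.cot_eq_cos_div_sin, div_neg]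
  simp only [h]
  exact (continuousOn_const.mul (Complex.continuous_ofReal.comp_continuousOn
    continuousOn_cot_pi_mul)).add (by fun_prop)

theorem pvKernel_periodic {R : ℝ → ℂ} (hR : Function.Periodic R 1) :
    Function.Periodic (pvKernel R) 1 := fun s => by
  simp only [pvKernel]
  rw [hR s, mul_add, mul_one, Real.cot_eq_cos_div_sin, Real.cot_eq_cos_div_sin, Real.sin_add_pi,
    Real.cos_add_pi, neg_div_neg_eq]

theorem measurableSet_lt_dist_int (r : ℝ) : MeasurableSet {s : ℝ | r < |s - round s|} := by
  have hround : Measurable fun s : ℝ => ((round s : ℤ) : ℝ) := by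
    simp only [round_eq]
    exact (measurable_from_top (f := fun n : ℤ => (n : ℝ))).comp
      (Int.measurable_floor.comp (measurable_id.add_const _))
  exact measurableSet_lt measurable_const
    (continuous_abs.measurable.comp (measurable_id'.sub hround))

open MeasureTheory in
/-- The truncated integral, folded to positive `s = |y - x|`. -/
theorem integral_truncated_eq {g : ℝ → ℂ} (hg : Function.Periodic g 1)
    (hg1 : ContinuousOn g (Set.Ioo 0 1)) (hg2 : ContinuousOn (fun s => g (-s)) (Set.Ioo 0 1))
    {f : ℝ → ℂ} (hf : Function.Periodic f 1) (hfc : Continuous f) (x : ℝ) {r : ℝ} (hr : 0 < r)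
    (hr1 : r < 1 / 2) :
    ∫ y in {y : ℝ | y ∈ Set.Icc (-1 / 2) (1 / 2) ∧ r < |(y - x) - round (y - x)|},
      g (y - x) * f y =
    ∫ s in r..(1 / 2), (g s * f (x + s) + g (-s) * f (x + -s)) := by
  set A : Set ℝ := {s | r < |s - round s|} with hA
  have hAm : MeasurableSet A := measurableSet_lt_dist_int r
  set G : ℝ → ℂ := fun s => g s * f (x + s) with hG
  set h : ℝ → ℂ := A.indicator G with hh
  -- With the excised set absorbed into an indicator, the integrand is periodic, so the window can
  -- be recentred at `y = x`.
  have hper : Function.Periodic h 1 := fun s => by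
    have h1 : s + 1 ∈ A ↔ s ∈ A := by
      simp [hA, round_add_one]
    by_cases hs : s ∈ A
    · rw [hh, Set.indicator_of_mem (h1.mpr hs), Set.indicator_of_mem hs, hG]
      simp only
      rw [hg s, ← add_assoc, hf]
    · rw [hh, Set.indicator_of_notMem (mt h1.mp hs), Set.indicator_of_notMem hs]
  have hS : {y : ℝ | y ∈ Set.Icc (-1 / 2 : ℝ) (1 / 2) ∧ r < |(y - x) - round (y - x)|} =
      Set.Icc (-1 / 2) (1 / 2) ∩ (fun y => y - x) ⁻¹' A := rfl
  have hAm' : MeasurableSet ((fun y => y - x) ⁻¹' A) := (measurable_id.sub_const x) hAm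
  rw [hS, ← setIntegral_indicator hAm', integral_Icc_eq_integral_Ioc,
    ← intervalIntegral.integral_of_le (by norm_num)]
  have h1 : ∀ y, ((fun y => y - x) ⁻¹' A).indicator (fun y => g (y - x) * f y) y = h (y - x) :=
    fun y => by
      classical
      rw [hh, hG, Set.indicator_apply, Set.indicator_apply]
      simp
  simp only [h1]
  rw [intervalIntegral.integral_comp_sub_right (fun y => h y) x,
    show (1 / 2 : ℝ) - x = (-1 / 2 - x) + 1 by ring, hper.intervalIntegral_add_eq _ (-1 / 2),
    show (-1 / 2 : ℝ) + 1 = 1 / 2 by norm_num, intervalIntegral.integral_of_le (by norm_num),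
    integral_Ioc_eq_integral_Ioo, hh, setIntegral_indicator hAm]
  have hset : Set.Ioo (-1 / 2 : ℝ) (1 / 2) ∩ A = Set.Ioo (-1 / 2) (-r) ∪ Set.Ioo r (1 / 2) := by
    ext s
    simp only [Set.mem_inter_iff, Set.mem_Ioo, hA, Set.mem_ofPred_eq, Set.mem_union]
    constructor
    · rintro ⟨⟨hs1, hs2⟩, hs3⟩
      rw [round_eq_zero_iff.mpr ⟨by linarith, hs2⟩, Int.cast_zero, sub_zero, lt_abs] at hs3
      rcases hs3 with hs3 | hs3
      · exact Or.inr ⟨hs3, hs2⟩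
      · exact Or.inl ⟨hs1, by linarith⟩
    · intro hs
      have hs' : -1 / 2 < s ∧ s < 1 / 2 ∧ r < |s| := by
        rcases hs with ⟨hs1, hs2⟩ | ⟨hs1, hs2⟩
        · exact ⟨hs1, by linarith, lt_abs.mpr (Or.inr (by linarith))⟩
        · exact ⟨by linarith, hs2, lt_abs.mpr (Or.inl hs1)⟩
      refine ⟨⟨hs'.1, hs'.2.1⟩, ?_⟩
      rw [round_eq_zero_iff.mpr ⟨by linarith [hs'.1], hs'.2.1⟩, Int.cast_zero, sub_zero]
      exact hs'.2.2
  have hGp : ContinuousOn G (Set.Icc r (1 / 2)) :=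
    (hg1.mono fun s hs => ⟨hr.trans_le hs.1, by linarith [hs.2]⟩).mul (by fun_prop)
  have hGn' : ContinuousOn (fun s => G (-s)) (Set.Icc r (1 / 2)) :=
    (hg2.mono fun s hs => ⟨hr.trans_le hs.1, by linarith [hs.2]⟩).mul (by fun_prop)
  have hGn : ContinuousOn G (Set.Icc (-1 / 2) (-r)) := by
    have := hGn'.comp (s := Set.Icc (-1 / 2) (-r)) (f := fun s => -s) (by fun_prop) fun s hs =>
      ⟨by linarith [hs.2], by linarith [hs.1]⟩
    simpa [Function.comp_def] using this
  have hi1 : IntervalIntegrable G volume r (1 / 2) :=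
    ContinuousOn.intervalIntegrable (by rwa [Set.uIcc_of_le hr1.le])
  have hi2 : IntervalIntegrable (fun s => G (-s)) volume r (1 / 2) :=
    ContinuousOn.intervalIntegrable (by rwa [Set.uIcc_of_le hr1.le])
  rw [hset, setIntegral_union (Set.disjoint_left.mpr fun s hs1 hs2 => by
      linarith [hs1.2, hs2.1]) measurableSet_Ioo
    (hGn.integrableOn_Icc.mono_set Set.Ioo_subset_Icc_self)
    (hGp.integrableOn_Icc.mono_set Set.Ioo_subset_Icc_self),
    ← integral_Ioc_eq_integral_Ioo, ← integral_Ioc_eq_integral_Ioo,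
    ← intervalIntegral.integral_of_le (by linarith), ← intervalIntegral.integral_of_le hr1.le,
    add_comm, intervalIntegral.integral_add hi1 hi2, intervalIntegral.integral_comp_neg]
  norm_num

theorem truncatedT_eq {ω₁ ω₂ γ : ℂ} {R : ℝ → ℂ} (hRc : Continuous R)
    (hRp : Function.Periodic R 1)
    (hR : ∀ s : ℝ, (∀ n : ℤ, s ≠ n) → Complex.I * ω₁ / Real.pi * kernelT ω₁ ω₂ γ s =
        -Complex.I * Complex.cot (Real.pi * s) + R s)
    {f : ℝ → ℂ} (hf : Function.Periodic f 1) (hfc : Continuous f) (x : ℝ) {r : ℝ} (hr : 0 < r)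
    (hr1 : r < 1 / 2) :
    truncatedT ω₁ ω₂ γ f x r =
      ∫ s in r..(1 / 2), (pvKernel R s * f (x + s) + pvKernel R (-s) * f (x + -s)) := by
  rw [truncatedT, ← integral_truncated_eq (pvKernel_periodic hRp) (continuousOn_pvKernel hRc)
    (continuousOn_pvKernel_neg hRc) hf hfc x hr hr1, ← MeasureTheory.integral_const_mul]
  refine MeasureTheory.setIntegral_congr_fun₀ ?_ fun y hy => ?_
  · refine MeasurableSet.nullMeasurableSet ?_
    exact measurableSet_Icc.inter ((measurable_id'.sub_const x) (measurableSet_lt_dist_int r))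
  · have hns : ∀ n : ℤ, y - x ≠ n := fun n hn => by
      have := hy.2
      rw [hn, round_intCast, sub_self, abs_zero] at this
      linarith
    rw [← mul_assoc, hR _ hns, pvKernel]
    simp

/-- The truncated multiplier. -/
def truncatedMultiplier (R : ℝ → ℂ) (k : ℤ) (r : ℝ) : ℂ :=
  ∫ s in r..(1 / 2), (pvKernel R s * mode k s + pvKernel R (-s) * mode k (-s))

/-- Folding `s` and `-s` together turns the odd factor `-i cot` into `2 cot(πs) sin(2πks)`, leaving
a regular remainder. -/
theorem truncatedMultiplier_eq {R : ℝ → ℂ} (hR : Continuous R) (k : ℤ) {r : ℝ} (hr : 0 < r)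
    (hr1 : r < 1 / 2) : truncatedMultiplier R k r =
      2 * (cotSinIntegral k r : ℂ) +
        ∫ s in r..(1 / 2), (R s * mode k s + R (-s) * mode k (-s)) := by
  have h1 : (2 * (cotSinIntegral k r : ℂ)) = ∫ s in r..(1 / 2),
      (2 * ((Real.cot (Real.pi * s) * Real.sin (2 * Real.pi * k * s) : ℝ) : ℂ)) := by
    rw [intervalIntegral.integral_const_mul, intervalIntegral.integral_ofReal, cotSinIntegral]
  rw [h1, ← intervalIntegral.integral_add, truncatedMultiplier]
  · refine intervalIntegral.integral_congr fun s _ => ?_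
    have hsin : (Real.sin (2 * Real.pi * k * s) : ℂ) =
        (mode (-k) s - mode k s) * Complex.I / 2 := by
      rw [Complex.ofReal_sin, Complex.sin, mode, mode]
      push_cast
      ring_nf
    have hcot : Real.cot (Real.pi * -s) = -Real.cot (Real.pi * s) := by
      simp [Real.cot_eq_cos_div_sin, div_neg]
    simp only [pvKernel, hcot, mode_neg]
    push_cast at hsin ⊢
    rw [hsin]
    ring
  · refine ContinuousOn.intervalIntegrable (continuousOn_const.mul
      (Complex.continuous_ofReal.comp_continuousOn ((continuousOn_cot_pi_mul.mono fun s hs => ?_).mul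
        (by fun_prop))))
    rw [Set.uIcc_of_le hr1.le] at hs
    exact ⟨hr.trans_le hs.1, by linarith [hs.2]⟩
  · apply Continuous.intervalIntegrable
    fun_prop

theorem HasFourier.norm_le {R : ℝ → ℂ} {b : ℤ → ℂ} (hR : HasFourier R b) (s : ℝ) :
    ‖R s‖ ≤ ∑' k, ‖b k‖ := by
  rw [← (hR.hasSum s).tsum_eq]
  refine (norm_tsum_le_tsum_norm ?_).trans ?_
  · simpa using hR.summable.norm
  · simp

theorem norm_truncatedMultiplier_le {R : ℝ → ℂ} {b : ℤ → ℂ} (hR : HasFourier R b) (k : ℤ) {r : ℝ}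
    (hr : 0 < r) (hr1 : r < 1 / 2) :
    ‖truncatedMultiplier R k r‖ ≤ 4 + ∑' k, ‖b k‖ := by
  set B := ∑' k, ‖b k‖ with hB
  have hB0 : 0 ≤ B := tsum_nonneg fun _ => norm_nonneg _
  have h1 : ‖∫ s in r..(1 / 2), (R s * mode k s + R (-s) * mode k (-s))‖ ≤
      (B + B) * |1 / 2 - r| :=
    intervalIntegral.norm_integral_le_of_norm_le_const fun s _ => by
      refine (norm_add_le _ _).trans ?_
      rw [norm_mul, norm_mul, norm_mode, norm_mode, mul_one, mul_one]
      exact add_le_add (hR.norm_le s) (hR.norm_le (-s))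
  rw [abs_of_pos (by linarith)] at h1
  have h2 := abs_cotSinIntegral_le k hr hr1
  rw [truncatedMultiplier_eq hR.continuous k hr hr1]
  refine (norm_add_le _ _).trans ?_
  rw [norm_mul, Complex.norm_real, Real.norm_eq_abs, Complex.norm_ofNat]
  nlinarith

theorem tendsto_truncatedMultiplier {R : ℝ → ℂ} {b : ℤ → ℂ} (hR : HasFourier R b) (k : ℤ) :
    Filter.Tendsto (truncatedMultiplier R k) (𝓝[>] 0) (𝓝 (k.sign + b (-k))) := by
  have hRc := hR.continuous
  have h1 := tendsto_integral_left
    (g := fun s => R s * mode k s + R (-s) * mode k (-s)) (by fun_prop) (1 / 2)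
  have h2 : ∫ s in (0 : ℝ)..(1 / 2), (R s * mode k s + R (-s) * mode k (-s)) = b (-k) := by
    rw [← hR.integral_mul_mode k, intervalIntegral.integral_add
      (by apply Continuous.intervalIntegrable; fun_prop)
      (by apply Continuous.intervalIntegrable; fun_prop),
      intervalIntegral.integral_comp_neg (fun s => R s * mode k s), add_comm, neg_zero,
      ← neg_div, intervalIntegral.integral_add_adjacent_intervals]
    all_goals
      apply Continuous.intervalIntegrable
      fun_prop
  rw [h2] at h1
  have h3 := ((Complex.continuous_ofReal.tendsto _).comp (tendsto_cotSinIntegral k)).const_mul 2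
  have h4 := h3.add h1
  rw [show (2 : ℂ) * (((k.sign : ℝ) / 2 : ℝ) : ℂ) = (k.sign : ℂ) by push_cast; ring] at h4
  refine h4.congr' ?_
  filter_upwards [eventually_Ioo_half] with r hr
  rw [truncatedMultiplier_eq hRc k hr.1 hr.2]
  rfl

/-- For fixed `r > 0` the kernel is bounded on the domain of integration, so the Fourier series of
`f` may be integrated termwise. -/
theorem hasSum_truncated {R : ℝ → ℂ} (hR : Continuous R) {f : ℝ → ℂ} {a : ℤ → ℂ}
    (hf : HasFourier f a) (x : ℝ) {r : ℝ} (hr : 0 < r) (hr1 : r < 1 / 2) :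
    HasSum (fun k => a k * mode k x * truncatedMultiplier R k r)
      (∫ s in r..(1 / 2), (pvKernel R s * f (x + s) + pvKernel R (-s) * f (x + -s))) := by
  have hsub : Set.Icc r (1 / 2) ⊆ Set.Ioo (0 : ℝ) 1 := fun s hs =>
    ⟨hr.trans_le hs.1, by linarith [hs.2]⟩
  have hc1 := (continuousOn_pvKernel hR).mono hsub
  have hc2 := (continuousOn_pvKernel_neg hR).mono hsub
  obtain ⟨C1, hC1⟩ := isCompact_Icc.exists_bound_of_continuousOn hc1
  obtain ⟨C2, hC2⟩ := isCompact_Icc.exists_bound_of_continuousOn hc2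
  have hmeas : ∀ k : ℤ, ContinuousOn (fun s => a k * mode k x *
      (pvKernel R s * mode k s + pvKernel R (-s) * mode k (-s))) (Set.Icc r (1 / 2)) := fun k =>
    continuousOn_const.mul ((hc1.mul (continuous_mode k).continuousOn).add
      (hc2.mul (by fun_prop)))
  have h := intervalIntegral.hasSum_integral_of_dominated_convergence
    (μ := MeasureTheory.volume) (a := r) (b := 1 / 2)
    (F := fun (k : ℤ) s => a k * mode k x *
      (pvKernel R s * mode k s + pvKernel R (-s) * mode k (-s)))
    (f := fun s => pvKernel R s * f (x + s) + pvKernel R (-s) * f (x + -s))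
    (fun k _ => ‖a k‖ * (C1 + C2)) (fun k => ?_) (fun k => ?_) ?_ ?_ ?_
  · simp only [intervalIntegral.integral_const_mul] at h
    exact h
  · rw [Set.uIoc_of_le hr1.le]
    exact ((hmeas k).mono Set.Ioc_subset_Icc_self).aestronglyMeasurable measurableSet_Ioc
  · refine Filter.Eventually.of_forall fun s hs => ?_
    rw [Set.uIoc_of_le hr1.le] at hs
    have hs' := Set.Ioc_subset_Icc_self hs
    rw [norm_mul, norm_mul, norm_mode, mul_one]
    refine mul_le_mul_of_nonneg_left ((norm_add_le _ _).trans ?_) (norm_nonneg _)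
    rw [norm_mul, norm_mul, norm_mode, norm_mode, mul_one, mul_one]
    exact add_le_add (hC1 s hs') (hC2 s hs')
  · exact Filter.Eventually.of_forall fun s _ => hf.summable.norm.mul_right _
  · simp
  · refine Filter.Eventually.of_forall fun s _ => ?_
    refine (((hf.hasSum (x + s)).mul_left (pvKernel R s)).add
      ((hf.hasSum (x + -s)).mul_left (pvKernel R (-s)))).congr_fun fun k => ?_
    rw [mode_add, mode_add]
    ring

/-- The symbol is bounded, because `sign k - c_k` is even summable. -/
theorem summable_structureConst_mul {ω₁ ω₂ δ γ : ℂ} (hδ : δ = ω₂ / ω₁) (hγ : 0 < γ.im)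
    (hγδ : γ.im < δ.im) {a : ℤ → ℂ} (ha : Summable a) :
    Summable fun k => structureConst δ γ k * a k := by
  obtain ⟨R, hR, -⟩ := exists_kernelT_eq hδ hγ hγδ
  set B := ∑' k, ‖(k.sign : ℂ) - structureConst δ γ k‖ with hB
  refine Summable.of_norm_bounded (ha.norm.mul_left (1 + B)) fun k => ?_
  rw [norm_mul]
  refine mul_le_mul_of_nonneg_right ?_ (norm_nonneg _)
  have h1 : ‖(k.sign : ℂ) - structureConst δ γ k‖ ≤ B :=
    hR.summable.norm.le_tsum k fun _ _ => norm_nonneg _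
  have h2 : ‖(k.sign : ℂ)‖ ≤ 1 := by
    rcases lt_trichotomy k 0 with h | h | h
    · simp [Int.sign_eq_neg_one_of_neg h]
    · simp [h]
    · simp [Int.sign_eq_one_of_pos h]
  have h3 := norm_sub_norm_le (structureConst δ γ k) (k.sign : ℂ)
  rw [norm_sub_rev] at h3
  linarith

/-- The operator `𝖳` is the Fourier multiplier with symbol `c_k`. -/
theorem tendsto_truncatedT {ω₁ ω₂ δ γ : ℂ} (hδ : δ = ω₂ / ω₁) (hγ : 0 < γ.im)
    (hγδ : γ.im < δ.im) {f : ℝ → ℂ} {a : ℤ → ℂ} (hf : HasFourier f a) (x : ℝ) :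
    Filter.Tendsto (fun r => truncatedT ω₁ ω₂ γ f x r) (𝓝[>] 0)
      (𝓝 (∑' k, structureConst δ γ k * a k * mode k x)) := by
  obtain ⟨R, hR, hker⟩ := exists_kernelT_eq hδ hγ hγδ
  have h := tendsto_tsum_of_dominated_convergence (𝓕 := 𝓝[>] (0 : ℝ))
    (f := fun r k => a k * mode k x * truncatedMultiplier R k r)
    (g := fun k => structureConst δ γ k * a k * mode k x)
    (hf.summable.norm.mul_right (4 + ∑' k, ‖(k.sign : ℂ) - structureConst δ γ k‖))
    (fun k => by
      have h1 := (tendsto_truncatedMultiplier hR k).const_mul (a k * mode k x)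
      -- The limit is `sign k + (sign (-k) - c_{-k})`, which is `c_k` by oddness of both functions.
      rw [structureConst_neg (hγ.trans hγδ), Int.sign_neg] at h1
      convert h1 using 2
      push_cast
      ring) (by
      filter_upwards [eventually_Ioo_half] with r hr k
      rw [norm_mul, norm_mul, norm_mode, mul_one]
      exact mul_le_mul_of_nonneg_left (norm_truncatedMultiplier_le hR k hr.1 hr.2)
        (norm_nonneg _))
  refine h.congr' ?_
  filter_upwards [eventually_Ioo_half] with r hr
  rw [truncatedT_eq hR.continuous hR.periodic hker hf.periodic hf.continuous x hr.1 hr.2]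
  exact (hasSum_truncated hR.continuous hf x hr.1 hr.2).tsum_eq

/-! ### Differentiation on the phase space -/

theorem hasSum_norm_phase (lam : Phase) : HasSum (fun m : Mode => ‖lam m‖) ‖lam‖ := by
  simpa using lp.hasSum_norm (p := 1) (by simp) lam

/-- The continuous linear map `λ ↦ ∑ λ_m φ_m` for a bounded family `φ`. -/
def phaseCLM {E : Type*} [NormedAddCommGroup E] [NormedSpace ℂ E] [CompleteSpace E]
    (φ : Mode → E) (C : ℝ) (hφ : ∀ m, ‖φ m‖ ≤ C) : Phase →L[ℂ] E :=
  have hs : ∀ lam : Phase, Summable fun m => ‖lam m • φ m‖ := fun lam =>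
    Summable.of_nonneg_of_le (fun _ => norm_nonneg _) (fun m => by
      rw [norm_smul]
      exact mul_le_mul_of_nonneg_left (hφ m) (norm_nonneg _))
      ((hasSum_norm_phase lam).summable.mul_right C)
  LinearMap.mkContinuous
    { toFun := fun lam => ∑' m, lam m • φ m
      map_add' := fun lam mu => by
        rw [← (hs lam).of_norm.tsum_add (hs mu).of_norm]
        refine tsum_congr fun m => ?_
        rw [← add_smul]
        rfl
      map_smul' := fun c lam => by
        rw [RingHom.id_apply, ← (hs lam).of_norm.tsum_const_smul]
        refine tsum_congr fun m => ?_
        rw [smul_smul]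
        rfl }
    C (fun lam => by
      refine (norm_tsum_le_tsum_norm (hs lam)).trans ?_
      rw [mul_comm, ← ((hasSum_norm_phase lam).mul_right C).tsum_eq]
      refine (hs lam).tsum_le_tsum (fun m => ?_) ((hasSum_norm_phase lam).summable.mul_right C)
      rw [norm_smul]
      exact mul_le_mul_of_nonneg_left (hφ m) (norm_nonneg _))

theorem hasSum_phaseCLM {E : Type*} [NormedAddCommGroup E] [NormedSpace ℂ E] [CompleteSpace E]
    (φ : Mode → E) (C : ℝ) (hφ : ∀ m, ‖φ m‖ ≤ C) (lam : Phase) :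
    HasSum (fun m => lam m • φ m) (phaseCLM φ C hφ lam) := by
  have hs : Summable fun m => ‖lam m • φ m‖ :=
    Summable.of_nonneg_of_le (fun _ => norm_nonneg _) (fun m => by
      rw [norm_smul]
      exact mul_le_mul_of_nonneg_left (hφ m) (norm_nonneg _))
      ((hasSum_norm_phase lam).summable.mul_right C)
  exact hs.of_norm.hasSum

theorem phaseCLM_single {E : Type*} [NormedAddCommGroup E] [NormedSpace ℂ E] [CompleteSpace E]
    (φ : Mode → E) (C : ℝ) (hφ : ∀ m, ‖φ m‖ ≤ C) (k : Mode) :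
    phaseCLM φ C hφ (lp.single 1 k (1 : ℂ)) = φ k := by
  refine (hasSum_phaseCLM φ C hφ _).unique ?_
  convert hasSum_single k fun m hm => ?_ using 1
  · simp
  · rw [lp.single_apply_ne _ _ _ hm, zero_smul]

theorem exp_eq_mode (n : ℤ) (x : ℝ) :
    Complex.exp (-(2 * Real.pi * Complex.I * n * x)) = mode (-n) x := by
  rw [mode]
  congr 1
  push_cast
  ring

/-- The exponent of `η(x)` as a linear functional of `λ`. -/
def etaExponent (x : ℝ) : Phase →L[ℂ] ℂ :=
  phaseCLM (fun m : Mode => mode (-(m : ℤ)) x) 1 fun m => by simp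

theorem hasSum_etaExponent (lam : Phase) (x : ℝ) :
    HasSum (fun m : Mode => lam m * mode (-(m : ℤ)) x) (etaExponent x lam) :=
  hasSum_phaseCLM _ _ _ lam

theorem eta_eq (ε : ℂ) (lam : Phase) (x : ℝ) :
    eta ε lam x = ε * Complex.exp (etaExponent x lam) := by
  rw [eta, ← (hasSum_etaExponent lam x).tsum_eq]
  simp only [exp_eq_mode]

theorem hasFDerivAt_eta (ε : ℂ) (lam : Phase) (x : ℝ) :
    HasFDerivAt (fun l => eta ε l x) (eta ε lam x • etaExponent x) lam := by
  simp only [eta_eq]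
  refine (((etaExponent x).hasFDerivAt.cexp).const_mul ε).congr_fderiv ?_
  rw [smul_smul]

theorem partialD_eta (ε : ℂ) (lam : Phase) (x : ℝ) (m : Mode) :
    partialD m (fun l => eta ε l x) lam = eta ε lam x * mode (-(m : ℤ)) x := by
  rw [partialD, (hasFDerivAt_eta ε lam x).fderiv]
  simp [etaExponent, phaseCLM_single]

theorem exists_hasFourier_etaExponent (lam : Phase) :
    ∃ a, HasFourier (fun x => etaExponent x lam) a :=
  exists_hasFourier_of_index (fun m : Mode => -(m : ℤ)) (fun m => lam m)
    (hasSum_norm_phase lam).summable (hasSum_etaExponent lam)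

theorem absFourier_prod_eta (ε : ℂ) (lam : Phase) (n : ℕ) :
    AbsFourier fun x : Fin n → ℝ => ∏ i, eta ε lam (x i) := by
  obtain ⟨a, ha⟩ := exists_hasFourier_etaExponent lam
  simp only [eta_eq]
  exact AbsFourier.prod _ fun i _ => (AbsFourier.const ε).mul (ha.comp_coord i).exp

/-- The sum of the values of a character at the coordinates. -/
def modeSum (n : ℕ) (k : ℤ) : (Fin n → ℝ) →ᵇ ℂ :=
  BoundedContinuousFunction.ofNormedAddCommGroup (fun x => ∑ i, mode k (x i)) (by fun_prop) n
    fun x => (norm_sum_le _ _).trans (by simp)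

theorem norm_modeSum_le (n : ℕ) (k : ℤ) : ‖modeSum n k‖ ≤ n :=
  BoundedContinuousFunction.norm_ofNormedAddCommGroup_le _ (Nat.cast_nonneg n) _

/-- `λ ↦ ∑_i ∑_m λ_m e^{-2πimx_i}`, with values in bounded continuous functions of `x`. -/
def totalExponent (n : ℕ) : Phase →L[ℂ] ((Fin n → ℝ) →ᵇ ℂ) :=
  phaseCLM (fun m : Mode => modeSum n (-(m : ℤ))) n fun _ => norm_modeSum_le _ _

theorem totalExponent_apply (n : ℕ) (lam : Phase) (x : Fin n → ℝ) :
    totalExponent n lam x = ∑ i, etaExponent (x i) lam := by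
  have h1 := (BoundedContinuousFunction.evalCLM ℂ x).hasSum
    (hasSum_phaseCLM (fun m : Mode => modeSum n (-(m : ℤ))) n (fun _ => norm_modeSum_le _ _) lam)
  have h2 := hasSum_sum (s := Finset.univ) fun i (_ : i ∈ Finset.univ) =>
    hasSum_etaExponent lam (x i)
  refine h1.unique (h2.congr_fun fun m => ?_)
  simp [modeSum, Finset.mul_sum]

theorem exp_apply {X : Type*} [TopologicalSpace X] (g : X →ᵇ ℂ) (x : X) :
    (NormedSpace.exp g) x = Complex.exp (g x) := by
  have h1 := (BoundedContinuousFunction.evalCLM ℂ x).hasSum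
    (NormedSpace.exp_series_hasSum_exp' (𝕂 := ℂ) g)
  rw [Complex.exp_eq_exp_ℂ]
  refine h1.unique ((NormedSpace.exp_series_hasSum_exp' (𝕂 := ℂ) (g x)).congr_fun fun N => ?_)
  simp

/-- Exhibits the integrand's dependence on `λ` as a Banach-algebra exponential of a continuous
linear map, so that no differentiation under the integral is needed. -/
theorem prod_eta_eq (ε : ℂ) (lam : Phase) {n : ℕ} (x : Fin n → ℝ) :
    ∏ i, eta ε lam (x i) = ε ^ n * (NormedSpace.exp (totalExponent n lam)) x := by
  rw [exp_apply, totalExponent_apply, Complex.exp_sum]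
  simp [eta_eq, Finset.prod_mul_distrib]

open MeasureTheory in
/-- Integration over the cube against a continuous weight. -/
def cubeFunctional {n : ℕ} (K : (Fin n → ℝ) → ℂ) (hK : Continuous K) :
    ((Fin n → ℝ) →ᵇ ℂ) →L[ℂ] ℂ :=
  have hint : ∀ g : (Fin n → ℝ) →ᵇ ℂ, IntegrableOn (fun x => K x * g x) (cube n) := fun g =>
    (hK.mul g.continuous).integrableOn_Icc
  LinearMap.mkContinuous
    { toFun := fun g => ∫ x in cube n, K x * g x
      map_add' := fun g h => by
        rw [← integral_add (hint g) (hint h)]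
        simp [mul_add]
      map_smul' := fun c g => by
        rw [RingHom.id_apply, smul_eq_mul, ← integral_const_mul]
        simp [mul_left_comm] }
    (∫ x in cube n, ‖K x‖) (fun g => by
      change ‖∫ x in cube n, K x * g x‖ ≤ _
      refine (norm_integral_le_integral_norm _).trans ?_
      rw [← integral_mul_const]
      refine integral_mono (hint g).norm ((hK.norm.integrableOn_Icc).mul_const _) fun x => ?_
      simp only [norm_mul]
      exact mul_le_mul_of_nonneg_left (g.norm_coe_le_norm x) (norm_nonneg _))

theorem cubeFunctional_apply {n : ℕ} (K : (Fin n → ℝ) → ℂ) (hK : Continuous K)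
    (g : (Fin n → ℝ) →ᵇ ℂ) : cubeFunctional K hK g = ∫ x in cube n, K x * g x := rfl

theorem hasFDerivAt_hamiltonian {δ γ : ℂ} (ε : ℂ) {n : ℕ}
    (hK : Continuous fun x : Fin n → ℝ => pairKernel δ γ x) (lam : Phase) :
    HasFDerivAt (hamiltonian δ γ ε n) ((prefactor δ γ n / (n.factorial : ℂ) * ε ^ n) •
      ((cubeFunctional _ hK).comp ((NormedSpace.exp (totalExponent n lam) •
        (1 : ((Fin n → ℝ) →ᵇ ℂ) →L[ℂ] ((Fin n → ℝ) →ᵇ ℂ))).comp (totalExponent n)))) lam := by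
  have h : hamiltonian δ γ ε n = fun l => (prefactor δ γ n / (n.factorial : ℂ) * ε ^ n) •
      cubeFunctional _ hK (NormedSpace.exp (totalExponent n l)) := by
    ext l
    simp only [hamiltonian, prod_eta_eq, cubeFunctional_apply, smul_eq_mul]
    simp only [mul_left_comm _ (ε ^ n), MeasureTheory.integral_const_mul]
    ring
  rw [h]
  have h1 := (hasFDerivAt_exp (𝕂 := ℂ) (x := totalExponent n lam)).comp lam
    (totalExponent n).hasFDerivAt
  have h2 := (cubeFunctional _ hK).hasFDerivAt.comp lam h1
  exact h2.const_smul (prefactor δ γ n / (n.factorial : ℂ) * ε ^ n)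

open MeasureTheory in
theorem integral_cube_comp_perm {n : ℕ} (σ : Equiv.Perm (Fin n)) (f : (Fin n → ℝ) → ℂ) :
    ∫ x in cube n, f (fun i => x (σ i)) = ∫ x in cube n, f x := by
  have hmp := volume_measurePreserving_piCongrLeft (fun _ : Fin n => ℝ) σ.symm
  have happ : ∀ x : Fin n → ℝ, MeasurableEquiv.piCongrLeft (fun _ : Fin n => ℝ) σ.symm x =
      fun i => x (σ i) := fun x => by
    ext i
    have := Equiv.piCongrLeft_apply_apply (fun _ : Fin n => ℝ) σ.symm x (σ i)
    simpa [MeasurableEquiv.coe_piCongrLeft] using this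
  have h := hmp.setIntegral_preimage_emb (MeasurableEquiv.measurableEmbedding _) f (cube n)
  have hpre : (MeasurableEquiv.piCongrLeft (fun _ : Fin n => ℝ) σ.symm) ⁻¹' cube n = cube n := by
    ext x
    simp only [Set.mem_preimage, happ, cube, Set.mem_Icc, Pi.le_def]
    constructor
    · rintro ⟨h1, h2⟩
      exact ⟨fun i => by simpa using h1 (σ.symm i), fun i => by simpa using h2 (σ.symm i)⟩
    · rintro ⟨h1, h2⟩
      exact ⟨fun i => h1 _, fun i => h2 _⟩
  rw [hpre] at h
  simpa only [happ] using h

theorem density_succ (δ γ ε : ℂ) (m : ℕ) (lam : Phase) (x : ℝ) :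
    density δ γ ε (m + 1) lam x = prefactor δ γ (m + 1) / (m.factorial : ℂ) *
      ∫ y in cube m, pairKernel δ γ (Fin.cons x y : Fin (m + 1) → ℝ) *
        ∏ i : Fin (m + 1), eta ε lam ((Fin.cons x y : Fin (m + 1) → ℝ) i) := rfl

theorem exists_hasFourier_density {δ γ : ℂ} (hγ : 0 < γ.im) (hγδ : γ.im < δ.im) (ε : ℂ) (m : ℕ)
    (lam : Phase) : ∃ h, HasFourier (density δ γ ε (m + 1) lam) h := by
  obtain ⟨b, hb⟩ := ((absFourier_pairKernel hγ hγδ (m + 1)).mul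
    (absFourier_prod_eta ε lam (m + 1))).exists_hasFourier_integral
  exact ⟨_, hb.const_mul (prefactor δ γ (m + 1) / (m.factorial : ℂ))⟩

/-- The integral of the density against a character, as an integral over the cube. -/
theorem integral_density_mul_mode {δ γ : ℂ} (hγ : 0 < γ.im) (hγδ : γ.im < δ.im) (ε : ℂ) (m : ℕ)
    (lam : Phase) (k : ℤ) :
    ∫ x in Set.Icc (-1 / 2 : ℝ) (1 / 2), density δ γ ε (m + 1) lam x * mode k x =
      prefactor δ γ (m + 1) / (m.factorial : ℂ) * ∫ z in cube (m + 1),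
        pairKernel δ γ z * (∏ i, eta ε lam (z i)) * mode k (z 0) := by
  have hc : Continuous fun z : Fin (m + 1) → ℝ =>
      pairKernel δ γ z * (∏ i, eta ε lam (z i)) * mode k (z 0) :=
    ((absFourier_pairKernel hγ hγδ _).mul (absFourier_prod_eta ε lam _)).continuous.mul
      (by fun_prop)
  rw [integral_cube_succ hc, ← MeasureTheory.integral_const_mul]
  refine MeasureTheory.integral_congr_ae (Filter.Eventually.of_forall fun x => ?_)
  simp only [density_succ, Fin.cons_zero, MeasureTheory.integral_mul_const]
  ring

/-- Differentiating the exponential inserts `∑ i, e^{-2πik x_i}`. By the symmetry of the integrand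
all `m + 1` summands contribute equally, and `(m + 1) / (m + 1)! = 1 / m!` is the normalisation of
the density. -/
theorem partialD_hamiltonian {δ γ : ℂ} (hγ : 0 < γ.im) (hγδ : γ.im < δ.im) (ε : ℂ) (m : ℕ)
    (lam : Phase) (k : Mode) :
    partialD k (hamiltonian δ γ ε (m + 1)) lam =
      ∫ x in Set.Icc (-1 / 2 : ℝ) (1 / 2), density δ γ ε (m + 1) lam x * mode (-(k : ℤ)) x := by
  have hK := (absFourier_pairKernel hγ hγδ (m + 1)).continuous
  set F : (Fin (m + 1) → ℝ) → ℂ := fun z => pairKernel δ γ z * ∏ i, eta ε lam (z i) with hF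
  have hFc : Continuous F := hK.mul (absFourier_prod_eta ε lam _).continuous
  have hsym : ∀ i : Fin (m + 1), ∫ z in cube (m + 1), F z * mode (-(k : ℤ)) (z i) =
      ∫ z in cube (m + 1), F z * mode (-(k : ℤ)) (z 0) := fun i => by
    rw [← integral_cube_comp_perm (Equiv.swap 0 i)]
    refine MeasureTheory.integral_congr_ae (Filter.Eventually.of_forall fun z => ?_)
    simp only [hF, pairKernel_comp_perm, Equiv.swap_apply_right]
    rw [Equiv.prod_comp (Equiv.swap 0 i) fun j => eta ε lam (z j)]
  have hsum : ∫ z in cube (m + 1), F z * modeSum (m + 1) (-(k : ℤ)) z =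
      (m + 1) * ∫ z in cube (m + 1), F z * mode (-(k : ℤ)) (z 0) := by
    have h1 : ∀ z : Fin (m + 1) → ℝ, F z * modeSum (m + 1) (-(k : ℤ)) z =
        ∑ i, F z * mode (-(k : ℤ)) (z i) := fun z => by
      simp [modeSum, Finset.mul_sum]
    simp only [h1]
    rw [MeasureTheory.integral_finsetSum (s := Finset.univ)
      (f := fun (i : Fin (m + 1)) z => F z * mode (-(k : ℤ)) (z i)) fun i _ => by
        rw [cube]
        exact Continuous.integrableOn_Icc (by fun_prop)]
    simp [hsym]
  rw [integral_density_mul_mode hγ hγδ, partialD, (hasFDerivAt_hamiltonian ε hK lam).fderiv]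
  simp only [smul_apply, ContinuousLinearMap.comp_apply, totalExponent,
    phaseCLM_single, smul_eq_mul, cubeFunctional_apply, one_apply_eq_self,
    BoundedContinuousFunction.mul_apply]
  rw [← totalExponent, mul_assoc, ← MeasureTheory.integral_const_mul]
  have h2 : ∀ z : Fin (m + 1) → ℝ, ε ^ (m + 1) * (pairKernel δ γ z *
      ((NormedSpace.exp (totalExponent (m + 1) lam)) z * modeSum (m + 1) (-(k : ℤ)) z)) =
      F z * modeSum (m + 1) (-(k : ℤ)) z := fun z => by
    simp only [hF, prod_eta_eq]
    ring
  simp only [h2, hsum]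
  have : (m.factorial : ℂ) ≠ 0 := by exact_mod_cast m.factorial_ne_zero
  have h3 : (m + 1 : ℂ) ≠ 0 := by exact_mod_cast m.succ_ne_zero
  rw [Nat.factorial_succ]
  push_cast
  field_simp
  rfl

theorem nat_mul_hamiltonian {δ γ : ℂ} (hγ : 0 < γ.im) (hγδ : γ.im < δ.im) (ε : ℂ) (m : ℕ)
    (lam : Phase) : ((m + 1 : ℕ) : ℂ) * hamiltonian δ γ ε (m + 1) lam =
      ∫ x in Set.Icc (-1 / 2 : ℝ) (1 / 2), density δ γ ε (m + 1) lam x := by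
  have h := integral_density_mul_mode hγ hγδ ε m lam 0
  simp only [mode_zero, mul_one] at h
  rw [h, hamiltonian, Nat.factorial_succ]
  have : (m.factorial : ℂ) ≠ 0 := by exact_mod_cast m.factorial_ne_zero
  have h3 : (m + 1 : ℂ) ≠ 0 := by exact_mod_cast m.succ_ne_zero
  push_cast
  field_simp

theorem partialD_hamiltonian_eq_coeff {δ γ ε : ℂ} (hγ : 0 < γ.im) (hγδ : γ.im < δ.im) {m : ℕ}
    {lam : Phase} {h : ℤ → ℂ} (hh : HasFourier (density δ γ ε (m + 1) lam) h) (k : Mode) :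
    partialD k (hamiltonian δ γ ε (m + 1)) lam = h k := by
  rw [partialD_hamiltonian hγ hγδ, MeasureTheory.integral_Icc_eq_integral_Ioc,
    ← intervalIntegral.integral_of_le (by norm_num), hh.integral_mul_mode, neg_neg]

theorem hasSum_bracketTerm {δ γ ε : ℂ} (hγ : 0 < γ.im) (hγδ : γ.im < δ.im) {m : ℕ}
    {lam : Phase} {h : ℤ → ℂ} (hh : HasFourier (density δ γ ε (m + 1) lam) h) (x : ℝ) :
    HasSum (bracketTerm δ γ (hamiltonian δ γ ε (m + 1)) (fun l => eta ε l x) lam)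
      (eta ε lam x * ∑' k : ℤ, structureConst δ γ k * h k * mode k x) := by
  have hs : Summable fun k : ℤ => structureConst δ γ k * h k * mode k x := by
    refine Summable.of_norm ?_
    -- The constants `c_k` depend on the periods only through `δ`, so the normalisation `ω₁ = 1`,
    -- `ω₂ = δ` suffices.
    simpa using (summable_structureConst_mul (ω₁ := 1) (div_one δ).symm hγ hγδ hh.summable).norm
  -- Passing between `ℤ` and the nonzero modes costs nothing because `c_0 = 0`.
  have h1 : HasSum (fun k : Mode => structureConst δ γ k * h k * mode k x)
      (∑' k : ℤ, structureConst δ γ k * h k * mode k x) := by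
    refine (hasSum_subtype_iff_of_support_subset
      (f := fun k : ℤ => structureConst δ γ k * h k * mode k x)
      (s := {k : ℤ | k ≠ 0}) fun k hk => ?_).mpr hs.hasSum
    rintro rfl
    simp at hk
  refine (h1.mul_left (eta ε lam x)).congr_fun fun k => ?_
  rw [bracketTerm, partialD_eta, partialD_hamiltonian_eq_coeff hγ hγδ hh]
  change _ * (_ * mode (- -(k : ℤ)) x) = _
  rw [neg_neg]
  ring

theorem bracket_hamiltonian_coord {δ γ ε : ℂ} (hγ : 0 < γ.im) (hγδ : γ.im < δ.im) {m : ℕ}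
    {lam : Phase} {h : ℤ → ℂ} (hh : HasFourier (density δ γ ε (m + 1) lam) h) (k : Mode) :
    bracket δ γ (hamiltonian δ γ ε (m + 1)) (coord k) lam =
      structureConst δ γ k.opp * h k.opp := by
  have hopp : k.opp.opp = k := Subtype.ext (neg_neg (k : ℤ))
  rw [bracket, tsum_eq_single k.opp]
  · simp [bracketTerm, partialD_coord, hopp, partialD_hamiltonian_eq_coeff hγ hγδ hh]
  · intro j hj
    have : j.opp ≠ k := fun h => hj (by rw [← h]; exact (Subtype.ext (neg_neg (j : ℤ))).symm)
    simp [bracketTerm, partialD_coord, this]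

/-- Differentiability in the `ℓ¹` norm allows the chain rule for the bounded functional `etaExponent
x`. The velocity has components `c_{-k} h_{-k}`, so replacing `k` by `-k` matches its pairing with
`e^{-2πikx}` to the bracket term by term. -/
theorem hasDerivAt_eta_of_flow {δ γ ε : ℂ} (hγ : 0 < γ.im) (hγδ : γ.im < δ.im) (m : ℕ)
    {Λ : ℝ → Phase} {t : ℝ} (hΛ : IsHamiltonianFlowAt δ γ (hamiltonian δ γ ε (m + 1)) Λ t)
    (x : ℝ) : HasDerivAt (fun s => eta ε (Λ s) x)
      (bracket δ γ (hamiltonian δ γ ε (m + 1)) (fun l => eta ε l x) (Λ t)) t := by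
  obtain ⟨v, hv, hvk⟩ := hΛ
  obtain ⟨h, hh⟩ := exists_hasFourier_density hγ hγδ ε m (Λ t)
  have hd := ((hasFDerivAt_eta ε (Λ t) x).restrictScalars ℝ).comp_hasDerivAt t hv
  suffices he : bracket δ γ (hamiltonian δ γ ε (m + 1)) (fun l => eta ε l x) (Λ t) =
      eta ε (Λ t) x * etaExponent x v from he ▸ hd
  have hinv : Function.Involutive Mode.opp := fun k => Subtype.ext (neg_neg (k : ℤ))
  rw [bracket, ← (hasSum_etaExponent v x).tsum_eq, ← tsum_mul_left,
    ← Equiv.tsum_eq hinv.toPerm]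
  refine tsum_congr fun k => ?_
  change bracketTerm δ γ _ _ _ k.opp = _
  rw [hvk, bracket_hamiltonian_coord hγ hγδ hh, bracketTerm, partialD_eta, hinv k,
    partialD_hamiltonian_eq_coeff hγ hγδ hh]
  ring

/-- The pair product is empty and the integral is over a point; the prefactor `ϑ₁(γ) / ϑ₁(γ)` equals
`1` because `ϑ₁(γ) ≠ 0`. -/
theorem density_one {δ γ : ℂ} (hγ : 0 < γ.im) (hγδ : γ.im < δ.im) (ε : ℂ) (lam : Phase)
    (x : ℝ) : density δ γ ε 1 lam x = eta ε lam x := by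
  have h := theta1_ne_zero (δ := δ) hγ hγδ
  rw [density_succ]
  have hpk : ∀ y : Fin 0 → ℝ, pairKernel δ γ (Fin.cons x y : Fin 1 → ℝ) = 1 := fun y => by
    rw [pairKernel, Fin.prod_univ_one]
    rfl
  simp [prefactor, hpk, h, volume_real_cube]

theorem convergesT_and_operatorT {ω₁ ω₂ δ γ : ℂ} (hδ : δ = ω₂ / ω₁) (hγ : 0 < γ.im)
    (hγδ : γ.im < δ.im) {f : ℝ → ℂ} {a : ℤ → ℂ} (hf : HasFourier f a) (x : ℝ) :
    ConvergesT ω₁ ω₂ γ f x ∧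
      operatorT ω₁ ω₂ γ f x = ∑' k, structureConst δ γ k * a k * mode k x :=
  have h := tendsto_truncatedT hδ hγ hγδ hf x
  ⟨⟨_, h⟩, h.limUnder_eq⟩

end EllipticILW

end

theorem mainTheorem4 (ω₁ ω₂ δ γ ε : ℂ) (hδ : δ = ω₂ / ω₁)
    (hδ_pos : 0 < δ.im) (hγ_pos : 0 < γ.im) (hγ_lt : γ.im < δ.im) :
    (∀ n : ℕ, 1 ≤ n →
      -- `n I_n = ∫ H_n`
      (∀ lam : Phase,
        (n : ℂ) * hamiltonian δ γ ε n lam =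
          ∫ x in Set.Icc (-1 / 2 : ℝ) (1 / 2), density δ γ ε n lam x) ∧
      -- `{I_n, η(x)} = η(x) 𝖳(H_n)(x)`, everything being well defined
      Differentiable ℂ (hamiltonian δ γ ε n) ∧
      (∀ x : ℝ, Differentiable ℂ (fun lam : Phase => eta ε lam x)) ∧
      (∀ (lam : Phase) (x : ℝ),
        BracketConverges δ γ (hamiltonian δ γ ε n) (fun l => eta ε l x) lam ∧
        ConvergesT ω₁ ω₂ γ (density δ γ ε n lam) x ∧
        bracket δ γ (hamiltonian δ γ ε n) (fun l => eta ε l x) lam =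
          eta ε lam x * operatorT ω₁ ω₂ γ (density δ γ ε n lam) x) ∧
      -- `∂η/∂t_n = {I_n, η(x)} = η(x) 𝖳(H_n)(x)` along the Hamiltonian flow of `I_n`
      (∀ (Λ : ℝ → Phase) (t : ℝ), IsHamiltonianFlowAt δ γ (hamiltonian δ γ ε n) Λ t →
        ∀ x : ℝ,
          HasDerivAt (fun s => eta ε (Λ s) x)
            (bracket δ γ (hamiltonian δ γ ε n) (fun l => eta ε l x) (Λ t)) t ∧
          HasDerivAt (fun s => eta ε (Λ s) x)
            (eta ε (Λ t) x * operatorT ω₁ ω₂ γ (density δ γ ε n (Λ t)) x) t)) ∧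
    -- the case `n = 1` is the integro-differential equation
    (∀ (lam : Phase) (x : ℝ), density δ γ ε 1 lam x = eta ε lam x) ∧
    (∀ (Λ : ℝ → Phase) (t : ℝ), IsHamiltonianFlowAt δ γ (hamiltonian δ γ ε 1) Λ t →
      ∀ x : ℝ, SatisfiesILWAt ω₁ ω₂ γ (fun y s => eta ε (Λ s) y) x t) := by

  have key : ∀ (n : ℕ), 1 ≤ n → ∀ (lam : Phase) (x : ℝ),
      BracketConverges δ γ (hamiltonian δ γ ε n) (fun l => eta ε l x) lam ∧
        ConvergesT ω₁ ω₂ γ (density δ γ ε n lam) x ∧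
        bracket δ γ (hamiltonian δ γ ε n) (fun l => eta ε l x) lam =
          eta ε lam x * operatorT ω₁ ω₂ γ (density δ γ ε n lam) x := by
    intro n hn lam x
    obtain ⟨m, rfl⟩ := Nat.exists_eq_add_of_le' hn
    obtain ⟨h, hh⟩ := exists_hasFourier_density hγ_pos hγ_lt ε m lam
    have hs := hasSum_bracketTerm hγ_pos hγ_lt hh x
    obtain ⟨hc, hT⟩ := convergesT_and_operatorT hδ hγ_pos hγ_lt hh x
    exact ⟨hs.summable, hc, by rw [hT]; exact hs.tsum_eq⟩
  have flow : ∀ (n : ℕ), 1 ≤ n → ∀ (Λ : ℝ → Phase) (t : ℝ),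
      IsHamiltonianFlowAt δ γ (hamiltonian δ γ ε n) Λ t → ∀ x : ℝ,
        HasDerivAt (fun s => eta ε (Λ s) x)
          (bracket δ γ (hamiltonian δ γ ε n) (fun l => eta ε l x) (Λ t)) t := by
    intro n hn Λ t hΛ x
    obtain ⟨m, rfl⟩ := Nat.exists_eq_add_of_le' hn
    exact hasDerivAt_eta_of_flow hγ_pos hγ_lt m hΛ x
  have hone := density_one hγ_pos hγ_lt ε
  refine ⟨fun n hn => ⟨fun lam => ?_, ?_, fun x lam =>
    (hasFDerivAt_eta ε lam x).differentiableAt, key n hn, fun Λ t hΛ x => ?_⟩, hone,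
    fun Λ t hΛ x => ?_⟩
  · obtain ⟨m, rfl⟩ := Nat.exists_eq_add_of_le' hn
    exact nat_mul_hamiltonian hγ_pos hγ_lt ε m lam
  · exact fun lam => (hasFDerivAt_hamiltonian ε
      (absFourier_pairKernel hγ_pos hγ_lt n).continuous lam).differentiableAt
  · have h := flow n hn Λ t hΛ x
    exact ⟨h, (key n hn (Λ t) x).2.2 ▸ h⟩
  · have h := flow 1 le_rfl Λ t hΛ x
    have hk := key 1 le_rfl (Λ t) x
    rw [funext (hone (Λ t))] at hk
    exact ⟨hk.2.1, hk.2.2 ▸ h⟩
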